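/- Let $A$ be a finite alphabet and let $\tau : A^* \to A^*$ be a substitution, that is, $\tau(uv) = \tau(u)\tau(v)$ for all words $u, v$. Suppose that $\tau$ is primitive: for all large enough $n$, every letter $a \in A$ occurs in $\tau^n(b)$ for every $b \in A$. Let $X_\tau \subset A^{\mathbb N}$ be the one-sided subshift of all infinite words each of whose finite factors is a factor of $\tau^n(a)$ for some $a \in A$ and $n \in \mathbb N$. Suppose that $\tau$ is aperiodic: $X_\tau$ contains no point $x$ with $\sigma^p(x) = x$ for some $p \geq 1$, where $\sigma(x)_i = x_{i+1}$ is the shift map. For one-sided subshifts $X, Y$, a dill map $\Phi : X \to Y$ is a continuous map with a continuous $s : X \to \mathbb N$ such that $\Phi(\sigma(x)) = \sigma^{s(x)}(\Phi(x))$ for all $x \in X$, and such that for every $x \in X$ there is $n \in \mathbb N$ with $s(\sigma^n(x)) > 0$. An implementation of $\Phi$ is a continuous map $\phi$ from $X$ to the (discrete) set of finite words with $\Phi(x) = \phi(x)\phi(\sigma(x))\phi(\sigma^2(x))\cdots$ for all $x \in X$; it exists, and it is unique if $Y$ contains no $\sigma$-periodic point. Put ${}^n\phi(x) = \phi(x)\phi(\sigma(x))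 \cdots \phi(\sigma^{n-1}(x))$. The map $\Phi$ has balanced growth if, for its implementation $\phi$, there are $\lambda \in \mathbb R$ and $D \in \mathbb N$ such that $\lim_{n} |{}^n\phi(x)|/n = \lambda$ for all $x \in X$, and $|{}^n\phi(x)| \in [\lambda n - D, \lambda n + D]$ for all $x \in X$ and $n \in \mathbb N$. A dill map $\Psi : Y \to X$ is an almost inverse of a dill map $\Phi : X \to Y$ if for every $x \in X$ there are $i, j \in \mathbb N$ with $\sigma^i(\Psi(\Phi(x))) = \sigma^j(x)$, and for every $y \in Y$ there are $i, j \in \mathbb N$ with $\sigma^i(\Phi(\Psi(y))) = \sigma^j(y)$. The substitution $\tau$ acts on $X_\tau$ as the dill map $x \mapsto \tau(x_0)\tau(x_1)\tau(x_2)\cdots$. Then this dill map $\tau : X_\tau \to X_\tau$ has an almost inverse. Moreover, if it has balanced growth, then it has an almost inverse that also has balanced growth. -/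

import Mathlib

namespace Dill

open Filter Topology SymbolicDynamics.FullShift

section General

variable {A B : Type*} [TopologicalSpace A] [TopologicalSpace B]

/-- `sh X n` is the `n`-th power of the shift map, restricted to the one-sided subshift `X`. -/
def sh (X : Subshift A ℕ) (n : ℕ) (x : X.carrier) : X.carrier :=
  ⟨shift n x.1, X.mapsTo n x.2⟩

/-- A dill map between one-sided subshifts: a continuous map that has a continuous cocycle `s`
which is positive somewhere on every forward orbit. -/
structure DillMap (X : Subshift A ℕ) (Y : Subshift B ℕ) where
  toFun : X.carrier → Y.carrier
  continuous_toFun : Continuous toFun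
  exists_nice_cocycle : ∃ s : X.carrier → ℕ, Continuous s ∧
    (∀ x, toFun (sh X 1 x) = sh Y (s x) (toFun x)) ∧
    ∀ x, ∃ n, 0 < s (sh X n x)

/-- The word `φ(x) φ(σ x) ⋯ φ(σ^(n-1) x)`. -/
def iter {X : Subshift A ℕ} (φ : X.carrier → List B) (n : ℕ) (x : X.carrier) : List B :=
  (List.range n).flatMap fun k => φ (sh X k x)

/-- `φ` is an implementation of `Φ`: it is continuous (finite words being isolated points), and
`Φ(x)` is the infinite concatenation `φ(x) φ(σ x) φ(σ² x) ⋯`. The words `iter φ n x` are prefixes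
of each other, so it is enough that every coordinate of `Φ(x)` is read off one of them. -/
def IsImplementation {X : Subshift A ℕ} {Y : Subshift B ℕ} (Φ : DillMap X Y)
    (φ : X.carrier → List B) : Prop :=
  IsLocallyConstant φ ∧
    ∀ x : X.carrier, ∀ i : ℕ, ∃ n : ℕ, (iter φ n x)[i]? = some ((Φ.toFun x).1 i)

/-- The invariant `Z(φ)` is well-defined and equal to `lam`. -/
def HasZ {X : Subshift A ℕ} (φ : X.carrier → List B) (lam : ℝ) : Prop :=
  ∀ x : X.carrier, Tendsto (fun n : ℕ => ((iter φ n x).length : ℝ) / (n : ℝ)) atTop (𝓝 lam)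

/-- For `lam = Z(φ)`, the invariant `D(φ)` is well-defined and equal to `D`. -/
def HasD {X : Subshift A ℕ} (φ : X.carrier → List B) (lam : ℝ) (D : ℕ) : Prop :=
  IsLeast {D : ℕ | ∀ (x : X.carrier) (n : ℕ),
    ((iter φ n x).length : ℝ) ∈ Set.Icc (lam * n - D) (lam * n + D)} D

/-- Balanced growth: the invariants `Z` and `D` are well-defined for the implementation. The
implementation is unique when `Y` has no shift-periodic point. -/
def BalancedGrowth {X : Subshift A ℕ} {Y : Subshift B ℕ} (Φ : DillMap X Y) : Prop :=
  ∃ φ : X.carrier → List B, IsImplementation Φ φ ∧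
    ∃ (lam : ℝ) (D : ℕ), HasZ φ lam ∧ HasD φ lam D

/-- Almost equivalence (used for dill maps, their compositions and the identity): the two images
of each point agree up to shifting them. -/
def AlmostEquiv {X : Subshift A ℕ} {Y : Subshift B ℕ} (f g : X.carrier → Y.carrier) : Prop :=
  ∀ x, ∃ i j : ℕ, sh Y i (f x) = sh Y j (g x)

def IsAlmostLeftInverse {X : Subshift A ℕ} {Y : Subshift B ℕ} (Ψ : DillMap Y X)
    (Φ : DillMap X Y) : Prop :=
  AlmostEquiv (X := X) (Y := X) (Ψ.toFun ∘ Φ.toFun) id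

def IsAlmostRightInverse {X : Subshift A ℕ} {Y : Subshift B ℕ} (Ψ : DillMap Y X)
    (Φ : DillMap X Y) : Prop :=
  AlmostEquiv (X := Y) (Y := Y) (Φ.toFun ∘ Ψ.toFun) id

def IsAlmostInverse {X : Subshift A ℕ} {Y : Subshift B ℕ} (Ψ : DillMap Y X)
    (Φ : DillMap X Y) : Prop :=
  IsAlmostLeftInverse Ψ Φ ∧ IsAlmostRightInverse Ψ Φ

def AlmostInvertible {X : Subshift A ℕ} {Y : Subshift B ℕ} (Φ : DillMap X Y) : Prop :=
  ∃ Ψ : DillMap Y X, IsAlmostInverse Ψ Φ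

end General

section Words

variable {A : Type*}

/-- The word `x_i x_(i+1) ⋯ x_(i+n-1)`. -/
def seg (x : ℕ → A) (i n : ℕ) : List A := (List.range n).map fun k => x (i + k)

/-- The finite word `w` is a factor of the infinite word `x`. -/
def FactorOf (w : List A) (x : ℕ → A) : Prop := ∃ i, w = seg x i w.length

/-- The word `τ^n(a)`, for a substitution given by the images `τ a` of the letters. -/
def power (τ : A → List A) (n : ℕ) (a : A) : List A := (fun w => w.flatMap τ)^[n] [a]

/-- The words that are a factor of no `τ^n(a)`. -/
def forbidden (τ : A → List A) : Set (List A) := {w | ∀ a n, ¬ w <:+: power τ n a}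

def NonErasing (τ : A → List A) : Prop := ∀ a, 0 < (τ a).length

/-- Every letter occurs in `τ^n(b)`, for every letter `b` and all large enough `n`. -/
def Primitive (τ : A → List A) : Prop := ∃ N, ∀ n ≥ N, ∀ a b, a ∈ power τ n b

theorem power_succ (τ : A → List A) (n : ℕ) (a : A) :
    power τ (n + 1) a = (power τ n a).flatMap τ := by
  unfold power; rw [Function.iterate_succ_apply']

theorem Primitive.nonErasing {τ : A → List A} (h : Primitive τ) : NonErasing τ := by
  obtain ⟨N, hN⟩ := h
  intro a
  rw [List.length_pos_iff]
  intro ha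
  have h0 : ∀ n, power τ (n + 1) a = [] := by
    intro n
    induction n with
    | zero => simp [power, ha]
    | succ n ih => rw [power_succ, ih]; rfl
  have h1 := hN (N + 1) (Nat.le_succ N) a a
  rw [h0] at h1
  simp at h1

theorem length_seg (x : ℕ → A) (i n : ℕ) : (seg x i n).length = n := by simp [seg]

theorem seg_append (x : ℕ → A) (i m n : ℕ) :
    seg x i (m + n) = seg x i m ++ seg x (i + m) n := by
  simp [seg, List.range_add, Function.comp_def, add_assoc]

theorem le_length_flatMap {τ : A → List A} (h : NonErasing τ) (w : List A) :
    w.length ≤ (w.flatMap τ).length := by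
  induction w with
  | nil => simp
  | cons a w ih => have := h a; simp only [List.flatMap_cons, List.length_append,
      List.length_cons]; omega

/-- The action of a non-erasing substitution on infinite words, `τ(x) = τ(x_0) τ(x_1) ⋯`: the `i`-th
letter is read off `τ(x_0) ⋯ τ(x_i)`, which has length at least `i + 1`. -/
def act (τ : A → List A) (h : NonErasing τ) (x : ℕ → A) (i : ℕ) : A :=
  ((seg x 0 (i + 1)).flatMap τ)[i]'(by
    have := le_length_flatMap h (seg x 0 (i + 1)); rw [length_seg] at this; omega)

theorem act_eq {τ : A → List A} (h : NonErasing τ) (x : ℕ → A) (n i : ℕ)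
    (hi : i < ((seg x 0 n).flatMap τ).length) : act τ h x i = ((seg x 0 n).flatMap τ)[i] := by
  have key : ∀ m k (_ : m ≤ k) (hm : i < ((seg x 0 m).flatMap τ).length)
      (hk : i < ((seg x 0 k).flatMap τ).length),
      ((seg x 0 m).flatMap τ)[i] = ((seg x 0 k).flatMap τ)[i] := by
    intro m k hmk hm hk
    obtain ⟨d, rfl⟩ := Nat.exists_eq_add_of_le hmk
    simp only [seg_append, List.flatMap_append]
    rw [List.getElem_append_left hm]
  unfold act
  rcases le_total n (i + 1) with hn | hn
  · exact (key _ _ hn _ _).symm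
  · exact key _ _ hn _ _

theorem seg_act {τ : A → List A} (h : NonErasing τ) (x : ℕ → A) (n : ℕ) :
    seg (act τ h x) 0 ((seg x 0 n).flatMap τ).length = (seg x 0 n).flatMap τ := by
  apply List.ext_getElem
  · rw [length_seg]
  · intro i h1 h2
    rw [← act_eq h x n i h2]
    simp [seg]

theorem act_shift {τ : A → List A} (h : NonErasing τ) (x : ℕ → A) :
    act τ h (shift 1 x) = shift (τ (x 0)).length (act τ h x) := by
  funext i
  have h1 : seg x 0 (1 + (i + 1)) = x 0 :: seg (shift 1 x) 0 (i + 1) := by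
    rw [seg_append]
    simp [seg]
  have h2 : i < ((seg (shift 1 x) 0 (i + 1)).flatMap τ).length := by
    have := le_length_flatMap h (seg (shift 1 x) 0 (i + 1)); rw [length_seg] at this; omega
  have h3 := act_eq h x (1 + (i + 1)) ((τ (x 0)).length + i) (by
    rw [h1, List.flatMap_cons, List.length_append]; omega)
  rw [shift_apply, h3, act_eq h _ (i + 1) i h2]
  simp only [h1, List.flatMap_cons]
  rw [List.getElem_append_right (by omega)]
  simp

end Words

section Substitutions

open Set

variable {A : Type*} [TopologicalSpace A] [DiscreteTopology A]

/-- The one-sided subshift `X_τ` of a substitution `τ`. -/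
def substShift (τ : A → List A) : Subshift A ℕ where
  carrier := {x | ∀ w ∈ forbidden τ, ¬ FactorOf w x}
  isClosed := by
    have : {x : ℕ → A | ∀ w ∈ forbidden τ, ¬ FactorOf w x} =
        ⋂ w ∈ forbidden τ, ⋂ i : ℕ, {x | w ≠ seg x i w.length} := by
      ext x; simp [FactorOf]
    rw [this]
    refine isClosed_biInter fun w _ => isClosed_iInter fun i => ?_
    have hc : Continuous fun (x : ℕ → A) (k : Fin w.length) => x (i + k) := by fun_prop
    have : {x : ℕ → A | w ≠ seg x i w.length} =
        (fun (x : ℕ → A) (k : Fin w.length) => x (i + k)) ⁻¹' {f | w ≠ List.ofFn f} := by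
      ext x
      have : seg x i w.length = List.ofFn fun k : Fin w.length => x (i + k) := by
        apply List.ext_getElem <;> simp [seg]
      simp [this]
    rw [this]
    exact (isClosed_discrete _).preimage hc
  mapsTo := by
    rintro g x hx w hw ⟨i, hi⟩
    refine hx w hw ⟨g + i, ?_⟩
    rw [hi]
    simp [seg, add_assoc]

/-- `X_τ` contains no shift-periodic point. -/
def Aperiodic (τ : A → List A) : Prop :=
  ∀ x ∈ (substShift τ).carrier, ∀ p : ℕ, 0 < p → shift p x ≠ x

theorem act_mem {τ : A → List A} (h : NonErasing τ) {x : ℕ → A}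
    (hx : x ∈ (substShift τ).carrier) : act τ h x ∈ (substShift τ).carrier := by
  rintro w hw ⟨i, hi⟩
  have h1 : ¬ seg x 0 (i + w.length) ∈ forbidden τ := fun hf =>
    hx _ hf ⟨0, by rw [length_seg]⟩
  simp only [forbidden, mem_ofPred_eq, not_forall, not_not] at h1
  obtain ⟨a, n, u, v, huv⟩ := h1
  have h2 := le_length_flatMap h (seg x 0 (i + w.length))
  rw [length_seg] at h2
  obtain ⟨d, hd⟩ := Nat.exists_eq_add_of_le h2
  have h3 := seg_act h x (i + w.length)
  rw [hd, seg_append, seg_append, zero_add, ← hi] at h3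
  apply hw a (n + 1)
  rw [power_succ, ← huv, List.flatMap_append, List.flatMap_append, ← h3]
  exact ⟨u.flatMap τ ++ seg (act τ h x) 0 i,
    seg (act τ h x) (0 + (i + w.length)) d ++ v.flatMap τ, by simp only [List.append_assoc]⟩

theorem continuous_act {τ : A → List A} (h : NonErasing τ) : Continuous (act τ h) := by
  refine continuous_pi fun i => ?_
  rw [continuous_discrete_rng]
  intro b
  rw [isOpen_iff_forall_mem_open]
  intro x hx
  refine ⟨cylinder (Finset.range (i + 1)) x, ?_, isOpen_cylinder _ _, fun _ _ => rfl⟩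
  intro y hy
  have : seg y 0 (i + 1) = seg x 0 (i + 1) := by
    simp only [seg, zero_add, List.map_inj_left, List.mem_range]
    intro k hk
    exact hy k (Finset.mem_range.2 hk)
  have h2 : act τ h y i = act τ h x i := by
    unfold act; simp only [this]
  simpa [h2] using hx

/-- A non-erasing substitution `τ`, as a dill map on `X_τ`. -/
def substMap (τ : A → List A) (h : NonErasing τ) : DillMap (substShift τ) (substShift τ) where
  toFun x := ⟨act τ h x.1, act_mem h x.2⟩
  continuous_toFun := ((continuous_act h).comp continuous_subtype_val).subtype_mk _
  exists_nice_cocycle := by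
    refine ⟨fun x => (τ (x.1 0)).length, ?_, ?_, ?_⟩
    · exact (continuous_of_discreteTopology (f := fun a : A => (τ a).length)).comp
        ((continuous_apply 0).comp continuous_subtype_val)
    · intro x
      exact Subtype.ext (act_shift h x.1)
    · intro x
      exact ⟨0, h _⟩

end Substitutions

end Dill

/-! By compactness every point `y` of the subshift is `σ^k(τ(x))` with `x` in the subshift and `k`
bounded. The almost inverse sends `y` to the tail of `x` that starts with the first letter whose
image begins at or after position `L` of `y`. The difficulty is to find a delay `L` for which this
does not depend on the choice of `(x, k)`.

This one-sided recognizability rests on uniform tail injectivity (`tailInjective`): if `τ(x)` and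
`τ(y)` have a common tail starting at bounded positions, so do `x` and `y`. Aperiodicity then forces
the two parsings into images of letters to line up (`exists_synchronization`). Primitivity enters
through two consequences: `τ` is non-erasing, and each letter occurs in the image of a letter.

Tail injectivity is proved by induction on the size of the alphabet. If `τ = α ∘ β` factors through
a smaller alphabet, it inherits the property from `β ∘ α` (`tailInjective_of_factor`). Otherwise `τ`
is elementary, and the defect theorem leaves so few relations between infinite words that the
overhang between two parsings determines all letters up to their next common cut
(`Elementary.agree`). Only finitely many overhangs occur, so by pigeonhole a common cut comes after
boundedly many letters, unless the word is eventually periodic (`Elementary.exists_coincidence`).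

For balanced growth, the inverse emits one letter per cut passed. Cut positions stay within a
bounded distance of `lam` times their index, so indices stay within a bounded distance of `lam⁻¹`
times the position. -/

namespace Dill

open Filter Topology SymbolicDynamics.FullShift

/-! ### Morphisms acting on infinite words, and the cuts of their images. -/

section InfiniteWords

variable {A B C : Type*}

/-- The infinite word obtained by writing the finite word `w` in front of `y`. -/
def app (w : List B) (y : ℕ → B) : ℕ → B :=
  fun i => if h : i < w.length then w[i] else y (i - w.length)

@[simp] theorem app_nil (y : ℕ → B) : app [] y = y := by
  funext i; simp [app]

theorem app_append (u v : List B) (y : ℕ → B) : app (u ++ v) y = app u (app v y) := by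
  funext i
  simp only [app, List.length_append]
  by_cases h1 : i < u.length
  · have : i < u.length + v.length := by omega
    simp [h1, this]
  · by_cases h2 : i < u.length + v.length
    · have : i - u.length < v.length := by omega
      simp only [h1, h2, this, dite_true, dite_false]
      rw [List.getElem_append_right (by omega)]
    · have : ¬ i - u.length < v.length := by omega
      simp only [h1, h2, this, dite_false]
      congr 1; omega

theorem shift_app (w : List B) (y : ℕ → B) : shift w.length (app w y) = y := by
  funext i; simp [app, shift_apply]

theorem app_injective (w : List B) : Function.Injective (app w) := fun y z h => by
  rw [← shift_app w y, h, shift_app]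

theorem seg_app (w : List B) (y : ℕ → B) : seg (app w y) 0 w.length = w := by
  apply List.ext_getElem
  · rw [length_seg]
  · intro i h1 h2
    simp [seg, app, h2]

theorem app_seg_shift (x : ℕ → B) (n : ℕ) : app (seg x 0 n) (shift n x) = x := by
  funext i
  by_cases h : i < n
  · simp [app, h, seg]
  · simp only [app, length_seg, h, dite_false, shift_apply]
    congr 1; omega

theorem app_cons_zero (a : B) (w : List B) (y : ℕ → B) : app (a :: w) y 0 = a := by
  simp [app]

theorem shift_shift (m n : ℕ) (x : ℕ → B) : shift m (shift n x) = shift (n + m) x := by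
  funext i; simp [shift_apply, add_assoc]

@[simp] theorem shift_zero' (x : ℕ → B) : shift 0 x = x := by
  funext i; simp [shift_apply]

theorem seg_one (x : ℕ → B) : seg x 0 1 = [x 0] := by simp [seg]

theorem seg_succ (x : ℕ → B) (n : ℕ) : seg x 0 (n + 1) = x 0 :: seg (shift 1 x) 0 n := by
  rw [add_comm, seg_append, seg_one]
  simp [seg]

theorem seg_shift (x : ℕ → B) (i n m : ℕ) : seg (shift m x) i n = seg x (m + i) n := by
  simp [seg, add_assoc]

/-- `cut σ x n` is the position at which `σ(x_n)` starts in `σ(x)`. -/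
def cut (σ : A → List B) (x : ℕ → A) (n : ℕ) : ℕ := ((seg x 0 n).flatMap σ).length

@[simp] theorem cut_zero (σ : A → List B) (x : ℕ → A) : cut σ x 0 = 0 := by
  simp [cut, seg]

theorem cut_add (σ : A → List B) (x : ℕ → A) (m n : ℕ) :
    cut σ x (m + n) = cut σ x m + cut σ (shift m x) n := by
  simp only [cut, seg_append, List.flatMap_append, List.length_append, seg_shift, zero_add,
    add_zero]

theorem cut_one (σ : A → List B) (x : ℕ → A) : cut σ x 1 = (σ (x 0)).length := by
  simp [cut, seg]

theorem cut_succ (σ : A → List B) (x : ℕ → A) (n : ℕ) :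
    cut σ x (n + 1) = cut σ x n + (σ (x n)).length := by
  rw [cut_add, cut_one]; simp [shift_apply]

theorem cut_strictMono {σ : A → List B} (h : ∀ a, 0 < (σ a).length) (x : ℕ → A) :
    StrictMono (cut σ x) :=
  strictMono_nat_of_lt_succ fun n => by rw [cut_succ]; have := h (x n); omega

theorem le_cut {σ : A → List B} (h : ∀ a, 0 < (σ a).length) (x : ℕ → A) (n : ℕ) :
    n ≤ cut σ x n := (cut_strictMono h x).le_apply

theorem cut_le {σ : A → List B} {M : ℕ} (hM : ∀ a, (σ a).length ≤ M) (x : ℕ → A) (n : ℕ) :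
    cut σ x n ≤ n * M := by
  induction n with
  | zero => simp
  | succ n ih => rw [cut_succ, Nat.succ_mul]; have := hM (x n); omega

theorem cut_congr (σ : A → List B) {x y : ℕ → A} {n : ℕ} (hxy : ∀ i < n, x i = y i) :
    cut σ x n = cut σ y n := by
  unfold cut
  congr 2
  simp only [seg, zero_add, List.map_inj_left, List.mem_range]
  exact hxy

/-- The image `σ(x_0) σ(x_1) ⋯` of an infinite word under a morphism between free monoids. -/
def gact (σ : A → List B) (h : ∀ a, 0 < (σ a).length) (x : ℕ → A) (i : ℕ) : B :=
  ((seg x 0 (i + 1)).flatMap σ)[i]'(by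
    have := le_cut h x (i + 1); unfold cut at this; omega)

variable {σ : A → List B} (h : ∀ a, 0 < (σ a).length)

theorem gact_cons (x : ℕ → A) : gact σ h x = app (σ (x 0)) (gact σ h (shift 1 x)) := by
  have key : ∀ m k (_ : m ≤ k) (x : ℕ → A) (i : ℕ) (hm : i < ((seg x 0 m).flatMap σ).length)
      (hk : i < ((seg x 0 k).flatMap σ).length),
      ((seg x 0 m).flatMap σ)[i] = ((seg x 0 k).flatMap σ)[i] := by
    intro m k hmk x i hm hk
    obtain ⟨d, rfl⟩ := Nat.exists_eq_add_of_le hmk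
    simp only [seg_append, List.flatMap_append]
    rw [List.getElem_append_left hm]
  funext i
  have h1 := le_cut h (shift 1 x) (i + 1)
  have h2 := cut_add σ x 1 (i + 1)
  rw [cut_one] at h2
  unfold gact app
  have h3 : i < ((seg x 0 (i + 2)).flatMap σ).length := by
    have := le_cut h x (i + 2); unfold cut at this; omega
  rw [key _ (i + 2) (by omega) x i _ h3]
  simp only [seg_succ x (i + 1), List.flatMap_cons]
  split_ifs with hi
  · rw [List.getElem_append_left hi]
  · rw [List.getElem_append_right (by omega)]
    refine (key _ _ (by omega) _ _ _ _).symm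

theorem gact_eq_app (x : ℕ → A) (n : ℕ) :
    gact σ h x = app ((seg x 0 n).flatMap σ) (gact σ h (shift n x)) := by
  induction n generalizing x with
  | zero => simp [seg]
  | succ n ih =>
    rw [seg_succ, List.flatMap_cons, app_append, gact_cons, ih (shift 1 x), shift_shift,
      add_comm 1 n]

theorem gact_app (w : List A) (x : ℕ → A) :
    gact σ h (app w x) = app (w.flatMap σ) (gact σ h x) := by
  rw [gact_eq_app h (app w x) w.length, seg_app, shift_app]

theorem shift_cut_gact (x : ℕ → A) (n : ℕ) :
    shift (cut σ x n) (gact σ h x) = gact σ h (shift n x) := by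
  rw [gact_eq_app h x n]; exact shift_app _ _

theorem shift_cut_add_gact (x : ℕ → A) (n k : ℕ) :
    shift (cut σ x n + k) (gact σ h x) = shift k (gact σ h (shift n x)) := by
  rw [← shift_shift, shift_cut_gact]

theorem seg_gact (x : ℕ → A) (n : ℕ) :
    seg (gact σ h x) 0 (cut σ x n) = (seg x 0 n).flatMap σ := by
  rw [gact_eq_app h x n]; exact seg_app _ _

/-- Unfolding the recursion `n` times fixes at least `n` letters, since `σ` is non-erasing. This
reduces identities between composed actions to a check on the first letter. -/
theorem gact_unique (F : (ℕ → A) → ℕ → B)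
    (hF : ∀ x, F x = app (σ (x 0)) (F (shift 1 x))) : F = gact σ h := by
  have key : ∀ n x, F x = app ((seg x 0 n).flatMap σ) (F (shift n x)) := by
    intro n
    induction n with
    | zero => intro x; simp [seg]
    | succ n ih =>
      intro x
      rw [seg_succ, List.flatMap_cons, app_append, hF, ih (shift 1 x), shift_shift, add_comm 1 n]
  funext x i
  rw [key (i + 1) x, gact_eq_app h x (i + 1)]
  have := le_cut h x (i + 1)
  unfold cut at this
  have h2 : i < ((seg x 0 (i + 1)).flatMap σ).length := by omega
  simp only [app, h2, dite_true]

theorem gact_gact {α : B → List C} (hα : ∀ b, 0 < (α b).length) {ρ : A → List C}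
    (hρ : ∀ a, 0 < (ρ a).length) (hσα : ∀ a, (σ a).flatMap α = ρ a) (x : ℕ → A) :
    gact α hα (gact σ h x) = gact ρ hρ x := by
  refine congrFun (gact_unique hρ (fun x => gact α hα (gact σ h x)) fun x => ?_) x
  rw [gact_cons h x, gact_app, hσα]

theorem gact_comp {q : C → A} {ρ : C → List B} (hρ : ∀ c, 0 < (ρ c).length)
    (hq : ∀ c, σ (q c) = ρ c) (x : ℕ → C) : gact σ h (q ∘ x) = gact ρ hρ x := by
  refine congrFun (gact_unique hρ (fun x => gact σ h (q ∘ x)) fun x => ?_) x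
  rw [gact_cons h, ← hq]; rfl

end InfiniteWords

/-! ### The defect theorem for relations between infinite words. -/

section Defect

universe u v

variable {B : Type v}

/-- The morphism `σ` factors through the free monoid on `n` letters, the second factor being
non-erasing. -/
def Factors {D : Type u} (σ : D → List B) (n : ℕ) : Prop :=
  ∃ (β : D → List (Fin n)) (α : Fin n → List B), (∀ c, 0 < (α c).length) ∧
    ∀ d, (β d).flatMap α = σ d

theorem Factors.of_card {D : Type u} [Fintype D] {σ : D → List B} (h : ∀ d, 0 < (σ d).length)
    {n : ℕ} (hn : Fintype.card D = n) : Factors σ n := by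
  let e := Fintype.equivFinOfCardEq hn
  exact ⟨fun d => [e d], fun c => σ (e.symm c), fun c => h _, fun d => by simp⟩

theorem Factors.comp {D E : Type*} {σ : D → List B} {α : E → List B} {β : D → List E}
    (hσ : ∀ d, (β d).flatMap α = σ d) {n : ℕ} (hα : Factors α n) : Factors σ n := by
  obtain ⟨β', α', h, h'⟩ := hα
  refine ⟨fun d => (β d).flatMap β', α', h, fun d => ?_⟩
  rw [← hσ, List.flatMap_assoc]
  simp only [h']

theorem app_eq_app {u w : List B} {y z : ℕ → B} (h : app u y = app w z)
    (hl : u.length ≤ w.length) : ∃ v, w = u ++ v ∧ y = app v z := by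
  obtain ⟨d, hd⟩ := Nat.exists_eq_add_of_le hl
  have h1 := seg_app w z
  rw [← h, hd, seg_append, seg_app] at h1
  refine ⟨_, h1.symm, app_injective u ?_⟩
  rw [← app_append, h1, h]

variable {D : Type u} {σ : D → List B}

/-- Merges `a` into `b`. The last clause records that no other letter moves, which is needed to see
that a second relation stays non-trivial. -/
theorem exists_identify {a b : D} (hab : a ≠ b) (hσ : σ a = σ b) :
    ∃ q : D → {d // d ≠ a}, (∀ d, σ (q d) = σ d) ∧
      ∀ d, (q d : D) = d ∨ (d = a ∧ (q d : D) = b) := by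
  classical
  refine ⟨fun d => if hd : d = a then ⟨b, hab.symm⟩ else ⟨d, hd⟩, fun d => ?_, fun d => ?_⟩ <;>
    by_cases hd : d = a <;> simp [hd, hσ]

/-- One step of a Euclidean algorithm: `β` sends `a` to `b a` and fixes the other letters, while `α`
sends `a` to the remainder `v`. The total length drops by that of `σ b`. Cancelling `σ b` in a
relation with heads `a` and `b` leaves a relation whose left head is `a`; the right head is not,
because no `β`-image begins with `a`. The clauses on heads serve to follow a second relation through
the step. -/
theorem exists_split [Fintype D] (h : ∀ d, 0 < (σ d).length) {a b : D} (hab : a ≠ b)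
    {v : List B} (hv : v ≠ []) (hσ : σ a = σ b ++ v) :
    ∃ (α : D → List B) (hα : ∀ d, 0 < (α d).length) (β : D → List D)
      (hβ : ∀ d, 0 < (β d).length),
      (∀ d, (β d).flatMap α = σ d) ∧ ∑ d, (α d).length < ∑ d, (σ d).length ∧
      (∀ X, gact σ h X = gact α hα (gact β hβ X)) ∧
      (∀ X, gact β hβ X 0 ≠ a ∧ (X 0 ≠ a → gact β hβ X 0 = X 0) ∧
        (X 0 = a → gact β hβ X 0 = b)) ∧
      ∀ X X', X 0 = a → X' 0 = b → gact σ h X = gact σ h X' →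
        ∃ W W', gact α hα W = gact α hα W' ∧ W 0 = a ∧ W' 0 ≠ a := by
  classical
  set α : D → List B := Function.update σ a v with hαdef
  set β : D → List D := fun d => if d = a then [b, a] else [d] with hβdef
  have hαa : α a = v := by simp [hαdef]
  have hαn : ∀ d, d ≠ a → α d = σ d := fun d hd => by simp [hαdef, hd]
  have hβa : β a = [b, a] := by simp [hβdef]
  have hβn : ∀ d, d ≠ a → β d = [d] := fun d hd => by simp [hβdef, hd]
  have hα : ∀ d, 0 < (α d).length := fun d => by
    by_cases hd : d = a
    · subst hd; rw [hαa]; exact List.length_pos_iff.2 hv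
    · rw [hαn d hd]; exact h d
  have hβ : ∀ d, 0 < (β d).length := fun d => by
    by_cases hd : d = a
    · subst hd; simp [hβa]
    · simp [hβn d hd]
  have hcomp : ∀ d, (β d).flatMap α = σ d := fun d => by
    by_cases hd : d = a
    · subst hd; simp [hβa, hαa, hαn b hab.symm, hσ]
    · simp [hβn d hd, hαn d hd]
  have hhead : ∀ X, gact β hβ X 0 ≠ a ∧ (X 0 ≠ a → gact β hβ X 0 = X 0) ∧
        (X 0 = a → gact β hβ X 0 = b) := fun X => by
    rw [gact_cons]
    by_cases hd : X 0 = a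
    · rw [hd, hβa, app_cons_zero]; simp [hab.symm]
    · rw [hβn _ hd, app_cons_zero]; simp [hd]
  refine ⟨α, hα, β, hβ, hcomp, ?_, fun X => (gact_gact hβ hα h hcomp X).symm, hhead, ?_⟩
  · refine Finset.sum_lt_sum (fun d _ => ?_) ⟨a, Finset.mem_univ _, ?_⟩
    · by_cases hd : d = a
      · subst hd; rw [hαa, hσ]; simp
      · rw [hαn d hd]
    · rw [hαa, hσ, List.length_append]; have := h b; omega
  · intro X X' hX hX' hXX
    refine ⟨app [a] (gact β hβ (shift 1 X)), gact β hβ (shift 1 X'), ?_, app_cons_zero _ _ _,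
      (hhead _).1⟩
    have h1 := gact_cons h X
    have h2 := gact_cons h X'
    rw [hX, hσ, app_append] at h1
    rw [hX'] at h2
    rw [gact_app, gact_gact hβ hα h hcomp, gact_gact hβ hα h hcomp]
    apply app_injective (σ b)
    rw [← h2, ← hXX, h1]
    simp [hαa]

/-- Defect theorem: a morphism with one non-trivial relation between infinite words factors
through an alphabet with one letter less. -/
theorem defect_one {n : ℕ} : ∀ (N : ℕ) {D : Type u} [Fintype D] {σ : D → List B}
    (h : ∀ d, 0 < (σ d).length), Fintype.card D = n + 1 → ∑ d, (σ d).length ≤ N →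
    ∀ X X' : ℕ → D, X 0 ≠ X' 0 → gact σ h X = gact σ h X' → Factors σ n := by
  intro N
  induction N with
  | zero =>
    intro D _ σ h _ hN X
    have := Finset.single_le_sum (f := fun d => (σ d).length) (fun _ _ => Nat.zero_le _)
      (Finset.mem_univ (X 0))
    have := h (X 0)
    omega
  | succ N ih =>
    intro D _ σ h hD hN
    suffices H : ∀ X X' : ℕ → D, X 0 ≠ X' 0 → gact σ h X = gact σ h X' →
        (σ (X' 0)).length ≤ (σ (X 0)).length → Factors σ n by
      intro X X' hne he
      rcases le_total (σ (X' 0)).length (σ (X 0)).length with hl | hl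
      · exact H X X' hne he hl
      · exact H X' X hne.symm he.symm hl
    intro X X' hne he hl
    classical
    obtain ⟨v, hv, -⟩ := app_eq_app (((gact_cons h X').symm.trans he.symm).trans (gact_cons h X)) hl
    -- With an empty remainder, merging two letters lowers the alphabet at once; otherwise splitting
    -- lowers the total length.
    by_cases hv0 : v = []
    · subst hv0
      obtain ⟨q, hq, -⟩ := exists_identify hne (by simpa using hv)
      refine Factors.comp (α := fun d : {d // d ≠ X 0} => σ d) (β := fun d => [q d]) (by simp [hq])
        (Factors.of_card (σ := fun d : {d // d ≠ X 0} => σ d) (fun d => h d) ?_)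
      rw [Fintype.card_subtype_compl, hD]; simp
    · obtain ⟨α, hα, β, hβ, hcomp, hsum, -, -, hrel⟩ := exists_split h hne hv0 hv
      obtain ⟨W, W', hW, h1, h2⟩ := hrel X X' rfl rfl he
      exact Factors.comp hcomp (ih hα hD (by omega) W W' (by rw [h1]; exact h2.symm) hW)

/-- Defect theorem: a morphism with two independent relations between infinite words factors
through an alphabet with two letters less. -/
theorem defect_two {n : ℕ} : ∀ (N : ℕ) {D : Type u} [Fintype D] {σ : D → List B}
    (h : ∀ d, 0 < (σ d).length), Fintype.card D = n + 2 → ∑ d, (σ d).length ≤ N →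
    ∀ X X' Y Y' : ℕ → D, X 0 ≠ X' 0 → Y 0 ≠ Y' 0 → s(X 0, X' 0) ≠ s(Y 0, Y' 0) →
      gact σ h X = gact σ h X' → gact σ h Y = gact σ h Y' → Factors σ n := by
  intro N
  induction N with
  | zero =>
    intro D _ σ h _ hN X
    have := Finset.single_le_sum (f := fun d => (σ d).length) (fun _ _ => Nat.zero_le _)
      (Finset.mem_univ (X 0))
    have := h (X 0)
    omega
  | succ N ih =>
    intro D _ σ h hD hN
    suffices H : ∀ X X' Y Y' : ℕ → D, X 0 ≠ X' 0 → Y 0 ≠ Y' 0 → s(X 0, X' 0) ≠ s(Y 0, Y' 0) →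
        gact σ h X = gact σ h X' → gact σ h Y = gact σ h Y' →
        (σ (X' 0)).length ≤ (σ (X 0)).length → Factors σ n by
      intro X X' Y Y' hne hne' hs he he'
      rcases le_total (σ (X' 0)).length (σ (X 0)).length with hl | hl
      · exact H X X' Y Y' hne hne' hs he he' hl
      · exact H X' X Y Y' hne.symm hne' (by rwa [Sym2.eq_swap]) he.symm he' hl
    intro X X' Y Y' hne hne' hs he he' hl
    classical
    obtain ⟨v, hv, -⟩ := app_eq_app (((gact_cons h X').symm.trans he.symm).trans (gact_cons h X)) hl
    rw [Ne, Sym2.eq_iff] at hs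
    -- Same dichotomy, now carrying the second relation along: after a merge its heads still differ,
    -- since its pair of heads is not the merged pair, and `defect_one` finishes.
    by_cases hv0 : v = []
    · subst hv0
      obtain ⟨q, hq, hq'⟩ := exists_identify hne (by simpa using hv)
      refine Factors.comp (α := fun d : {d // d ≠ X 0} => σ d) (β := fun d => [q d]) (by simp [hq])
        (defect_one (σ := fun d : {d // d ≠ X 0} => σ d) _ (fun d => h d) ?_ le_rfl (q ∘ Y) (q ∘ Y') ?_ ?_)
      · rw [Fintype.card_subtype_compl, hD, Fintype.card_unique]; rfl
      · intro hc
        have hc' := congrArg Subtype.val hc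
        change (q (Y 0) : D) = q (Y' 0) at hc'
        rcases hq' (Y 0) with h1 | ⟨h1, h2⟩ <;> rcases hq' (Y' 0) with h3 | ⟨h3, h4⟩ <;>
          clear ih <;> grind only
      · rw [gact_comp (σ := fun d : {d // d ≠ X 0} => σ d) _ h hq,
          gact_comp (σ := fun d : {d // d ≠ X 0} => σ d) _ h hq, he']
    · obtain ⟨α, hα, β, hβ, hcomp, hsum, hact, hhead, hrel⟩ := exists_split h hne hv0 hv
      obtain ⟨W, W', hW, h1, h2⟩ := hrel X X' rfl rfl he
      refine Factors.comp hcomp (ih hα hD (by omega) W W' (gact β hβ Y) (gact β hβ Y')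
        (by rw [h1]; exact h2.symm) ?_ ?_ hW (by rw [← hact, ← hact, he']))
      -- The heads of the second relation could collide only through `a` turning into `b`, that is,
      -- if its pair were `{a, b}`. In the next goal, the pairs differ because only the first one
      -- contains `a`.
      · have hY := hhead Y
        have hY' := hhead Y'
        intro hc
        by_cases c1 : Y 0 = X 0 <;> by_cases c2 : Y' 0 = X 0
        · exact hne' (c1.trans c2.symm)
        · rw [hY.2.2 c1, hY'.2.1 c2] at hc
          exact hs (.inl ⟨c1.symm, hc⟩)
        · rw [hY.2.1 c1, hY'.2.2 c2] at hc
          exact hs (.inr ⟨c2.symm, hc.symm⟩)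
        · rw [hY.2.1 c1, hY'.2.1 c2] at hc
          exact hne' hc
      · have hY := (hhead Y).1
        have hY' := (hhead Y').1
        rw [Ne, Sym2.eq_iff]
        clear ih hact hhead hrel hcomp
        grind only

end Defect

/-! ### Elementary morphisms: injectivity and common cuts of two parsings. -/

section Elementary

universe u v

variable {A : Type u} {B : Type v}

/-- A morphism that does not factor through a smaller alphabet. -/
def Elementary [Fintype A] (σ : A → List B) : Prop := ∀ n, Factors σ n → Fintype.card A ≤ n

variable {σ : A → List B}

theorem Elementary.injective [Fintype A] (hE : Elementary σ) (h : ∀ a, 0 < (σ a).length) :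
    Function.Injective (gact σ h) := by
  classical
  intro X X' he
  by_contra hne
  have hex : ∃ i, X i ≠ X' i := by
    by_contra hc
    push Not at hc
    exact hne (funext hc)
  set n := Nat.find hex
  have hn : X n ≠ X' n := Nat.find_spec hex
  have hlt : ∀ i < n, X i = X' i := fun i hi => not_not.1 (Nat.find_min hex hi)
  have hcut : cut σ X n = cut σ X' n := cut_congr σ hlt
  have hrel : gact σ h (shift n X) = gact σ h (shift n X') := by
    rw [← shift_cut_gact, ← shift_cut_gact, he, hcut]
  obtain ⟨m, hm⟩ : ∃ m, Fintype.card A = m + 1 :=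
    Nat.exists_eq_add_one.2 (Fintype.card_pos_iff.2 ⟨X 0⟩)
  have := hE _ (defect_one _ h hm le_rfl _ _ (by simpa [shift_apply] using hn) hrel)
  omega

/-- Adjoin a letter `none` with image `e`. The two equations become relations with heads `{X 0,
none}` and `{Y 0, none}`. If these pairs differed, `defect_two` would remove two letters from an
alphabet with one extra letter, so `σ` would factor through fewer letters than `A` has. -/
theorem Elementary.head_eq [Fintype A] (hE : Elementary σ) (h : ∀ a, 0 < (σ a).length) {e : List B}
    (he : e ≠ []) {X X' Y Y' : ℕ → A} (hX : gact σ h X = app e (gact σ h X'))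
    (hY : gact σ h Y = app e (gact σ h Y')) : X 0 = Y 0 := by
  by_contra hne
  obtain ⟨m, hm⟩ : ∃ m, Fintype.card A = m + 1 :=
    Nat.exists_eq_add_one.2 (Fintype.card_pos_iff.2 ⟨X 0⟩)
  let ρ : Option A → List B := fun o => o.elim e σ
  have hρ : ∀ o, 0 < (ρ o).length := by
    rintro (_ | a)
    · exact List.length_pos_iff.2 he
    · exact h a
  have hsome : ∀ Z : ℕ → A, gact ρ hρ (some ∘ Z) = gact σ h Z :=
    gact_comp hρ h fun _ => rfl
  have hrel : ∀ Z Z' : ℕ → A, gact σ h Z = app e (gact σ h Z') →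
      gact ρ hρ (some ∘ Z) = gact ρ hρ (app [none] (some ∘ Z')) := by
    intro Z Z' hZ
    rw [gact_app, hsome, hsome, hZ]
    simp [ρ]
  have := defect_two (n := m) _ hρ (by rw [Fintype.card_option, hm]) le_rfl
    (some ∘ X) (app [none] (some ∘ X')) (some ∘ Y) (app [none] (some ∘ Y'))
    (by simp [app_cons_zero]) (by simp [app_cons_zero])
    (by simpa [app_cons_zero] using hne) (hrel _ _ hX) (hrel _ _ hY)
  have := hE _ (Factors.comp (β := fun a => [some a]) (by simp [ρ]) this)
  omega

/-- The overhang `e` determines the letters up to the next common cut. `Elementary.head_eq` fixes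
the first letter; removing it produces a new overhang, which lies on the other side when `σ (X 0)`
is longer than `e`, so the roles of `X` and `X'` are then exchanged. Only letters starting before
`L` are compared, and no common cut is allowed there because an empty overhang carries no
information. -/
theorem Elementary.agree [Fintype A] (hE : Elementary σ) (h : ∀ a, 0 < (σ a).length)
    (L : ℕ) :
    ∀ (X X' Y Y' : ℕ → A) (e : List B), e ≠ [] → gact σ h X = app e (gact σ h X') →
      gact σ h Y = app e (gact σ h Y') →
      (∀ i j, cut σ X i = e.length + cut σ X' j → L ≤ cut σ X i) →
      (∀ i, cut σ X i < L → X i = Y i) ∧ ∀ j, e.length + cut σ X' j < L → X' j = Y' j := by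
  induction L using Nat.strong_induction_on with
  | _ L ih =>
    intro X X' Y Y' e he hX hY hco
    have hhead := hE.head_eq h he hX hY
    have hXc := (gact_cons h X).symm.trans hX
    have hYc := (gact_cons h Y).symm.trans hY
    have hepos := List.length_pos_iff.2 he
    have hapos := h (X 0)
    have hcut : ∀ i, cut σ X (i + 1) = (σ (X 0)).length + cut σ (shift 1 X) i := fun i => by
      rw [add_comm, cut_add, cut_one]
    rw [← hhead] at hYc
    rcases le_or_gt (σ (X 0)).length e.length with hl | hl
    · obtain ⟨f, hf, hX1⟩ := app_eq_app hXc hl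
      have hY1 : gact σ h (shift 1 Y) = app f (gact σ h Y') := by
        rw [hf, app_append] at hYc
        exact app_injective _ hYc
      have hlen : e.length = (σ (X 0)).length + f.length := by rw [hf, List.length_append]
      by_cases hLa : L ≤ (σ (X 0)).length
      · refine ⟨fun i hi => ?_, fun j hj => by omega⟩
        cases i with
        | zero => exact hhead
        | succ i => rw [hcut] at hi; omega
      have hf0 : f ≠ [] := by
        rintro rfl
        have := hco 1 0 (by rw [cut_one, cut_zero]; simpa using hlen.symm)
        rw [cut_one] at this
        exact hLa this
      obtain ⟨h1, h2⟩ := ih (L - (σ (X 0)).length) (by omega) (shift 1 X) X' (shift 1 Y) Y' f hf0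
        hX1 hY1 fun i j hij => by
          have := hco (i + 1) j (by rw [hcut]; omega)
          rw [hcut] at this; omega
      refine ⟨fun i hi => ?_, fun j hj => h2 j (by omega)⟩
      cases i with
      | zero => exact hhead
      | succ i =>
        rw [hcut] at hi
        simpa [shift_apply, add_comm] using h1 i (by omega)
    · obtain ⟨f, hf, hX1⟩ := app_eq_app hXc.symm hl.le
      have hY1 : gact σ h Y' = app f (gact σ h (shift 1 Y)) := by
        rw [hf, app_append] at hYc
        exact (app_injective _ hYc).symm
      have hlen : (σ (X 0)).length = e.length + f.length := by
        conv_lhs => rw [hf]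
        rw [List.length_append]
      have hf0 : f ≠ [] := List.length_pos_iff.1 (by omega)
      by_cases hL : L = 0
      · exact ⟨fun i hi => by omega, fun j hj => by omega⟩
      obtain ⟨h1, h2⟩ := ih (L - e.length) (by omega) X' (shift 1 X) Y' (shift 1 Y) f hf0
        hX1 hY1 fun i j hij => by
          have := hco (j + 1) i (by rw [hcut]; omega)
          rw [hcut] at this; omega
      refine ⟨fun i hi => ?_, fun j hj => h1 j (by omega)⟩
      cases i with
      | zero => exact hhead
      | succ i =>
        rw [hcut] at hi
        simpa [shift_apply, add_comm] using h2 i (by omega)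

/-- The overhang of the first cut of `X'` after the `i`-th cut of `X`. -/
theorem exists_overhang (h : ∀ a, 0 < (σ a).length) {M : ℕ} (hM : ∀ a, (σ a).length ≤ M)
    {X X' : ℕ → A} {e : List B} (he : gact σ h X = app e (gact σ h X')) (i : ℕ) :
    ∃ (j : ℕ) (f : List B), gact σ h (shift i X) = app f (gact σ h (shift j X')) ∧
      cut σ X i + f.length = e.length + cut σ X' j ∧ f.length ≤ max e.length M ∧
      ∀ k, cut σ X i ≤ e.length + cut σ X' k → j ≤ k := by
  classical
  have hex : ∃ j, cut σ X i ≤ e.length + cut σ X' j :=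
    ⟨cut σ X i, (le_cut h X' _).trans (Nat.le_add_left _ _)⟩
  set j := Nat.find hex
  have hj : cut σ X i ≤ e.length + cut σ X' j := Nat.find_spec hex
  obtain ⟨o, ho⟩ := Nat.exists_eq_add_of_le hj
  refine ⟨j, seg (gact σ h (shift i X)) 0 o, ?_, by rw [length_seg, ho], ?_,
    fun k hk => Nat.find_min' hex hk⟩
  · conv_lhs => rw [← app_seg_shift (gact σ h (shift i X)) o]
    congr 1
    rw [← shift_cut_gact, shift_shift, ← ho, he, ← shift_shift, shift_app, shift_cut_gact]
  · rw [length_seg]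
    rcases Nat.eq_zero_or_pos j with h0 | h0
    · rw [h0, cut_zero] at ho; omega
    · obtain ⟨k, hk⟩ := Nat.exists_eq_add_one.2 h0
      have h1 : ¬ cut σ X i ≤ e.length + cut σ X' k := Nat.find_min hex (by omega)
      rw [hk, cut_succ] at ho
      have := hM (X' k)
      omega

/-- The constant `S` is the number of possible overhangs. Without a common cut among the first `S`
letters, two cuts of `X` have the same non-empty overhang, and what follows them agrees up to the
next common cut. Past a common cut the tails are equal by injectivity. -/
theorem Elementary.exists_coincidence [Fintype A] [Finite B] (hE : Elementary σ)
    (h : ∀ a, 0 < (σ a).length) (K : ℕ) :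
    ∃ S, ∀ (X X' : ℕ → A) (e : List B), e.length ≤ K → gact σ h X = app e (gact σ h X') →
      (∀ m n, m < n → shift m X ≠ shift n X) →
      ∃ i j, i ≤ S ∧ cut σ X i = e.length + cut σ X' j ∧ shift i X = shift j X' := by
  classical
  obtain ⟨M, hM⟩ : ∃ M, ∀ a, (σ a).length ≤ M :=
    ⟨∑ a, (σ a).length, fun a =>
      Finset.single_le_sum (f := fun a => (σ a).length) (fun _ _ => Nat.zero_le _)
        (Finset.mem_univ a)⟩
  have hfin : {w : List B | w.length ≤ max K M}.Finite := List.finite_length_le _ _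
  refine ⟨hfin.toFinset.card, fun X X' e heK he hX => ?_⟩
  set S := hfin.toFinset.card
  suffices H : ∃ i j, i ≤ S ∧ cut σ X i = e.length + cut σ X' j by
    obtain ⟨i, j, hi, hij⟩ := H
    refine ⟨i, j, hi, hij, hE.injective h ?_⟩
    rw [← shift_cut_gact, ← shift_cut_gact, he, hij, ← shift_shift, shift_app]
  by_contra hno
  push Not at hno
  choose jj f hf hcut hlen hmin using exists_overhang h hM he
  obtain ⟨a, ha, b, hb, hab, hfab⟩ := Finset.exists_ne_map_eq_of_card_lt_of_maps_to
    (s := Finset.range (S + 1)) (t := hfin.toFinset) (f := f) (by simp [S]) (by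
      intro i _
      simp only [Set.Finite.coe_toFinset, Set.mem_ofPred_eq]
      exact (hlen i).trans (max_le_max heK le_rfl))
  obtain ⟨i, i2, hii, hi2, hfi⟩ : ∃ i i2, i < i2 ∧ i2 ≤ S ∧ f i2 = f i := by
    simp only [Finset.mem_range] at ha hb
    rcases lt_or_gt_of_ne hab with hlt | hlt
    · exact ⟨a, b, hlt, by omega, hfab.symm⟩
    · exact ⟨b, a, hlt, by omega, hfab⟩
  have hf0 : f i2 ≠ [] := by
    intro h0
    have := hcut i2
    rw [h0] at this
    exact hno i2 (jj i2) hi2 (by simpa using this)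
  have hXi := hf i
  rw [← hfi] at hXi
  have hagree := fun L => hE.agree h L _ _ _ _ (f i2) hf0 (hf i2) hXi
  by_cases hP : ∃ p, ∃ r s, cut σ X r = p ∧ e.length + cut σ X' s = p
  -- The stretch from cut `i2` to the first common cut `p` also follows cut `i`, which produces a
  -- common cut before `p`.
  · set p := Nat.find hP
    obtain ⟨r, s, hr, hs⟩ := Nat.find_spec hP
    have hSr : S < r := by
      by_contra hc
      exact hno r s (by omega) (hr.trans hs.symm)
    obtain ⟨r', rfl⟩ := Nat.exists_eq_add_of_le (hi2.trans hSr.le)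
    obtain ⟨s', rfl⟩ := Nat.exists_eq_add_of_le (hmin i2 s (by
      rw [hs, ← hr, cut_add]; exact Nat.le_add_right _ _))
    have hr2 := hr
    have hs2 := hs
    rw [cut_add] at hr2 hs2
    have hc := hcut i2
    obtain ⟨h1, h2⟩ := hagree (cut σ (shift i2 X) r') fun a b hab => by
      have := Nat.find_min' hP ⟨i2 + a, jj i2 + b, rfl, by rw [cut_add, cut_add]; omega⟩
      rw [cut_add] at this
      change p ≤ _ at this
      change _ = p at hr2
      omega
    have h3 : cut σ (shift i2 X) r' = cut σ (shift i X) r' :=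
      cut_congr σ fun k hk => h1 k (cut_strictMono h _ hk)
    have h4 : cut σ (shift (jj i2) X') s' = cut σ (shift (jj i) X') s' :=
      cut_congr σ fun k hk => h2 k (by
        have := cut_strictMono h (shift (jj i2) X') hk
        change _ = p at hr2 hs2
        omega)
    have h5 := cut_strictMono h X hii
    have hci := hcut i
    rw [hfi] at hc
    refine Nat.find_min hP (m := cut σ X i + cut σ (shift i X) r') ?_
      ⟨i + r', jj i + s', cut_add _ _ _ _, ?_⟩
    · change _ < p; change _ = p at hr2; omega
    · rw [cut_add]; change _ = p at hr2 hs2; omega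
  -- With no common cut at all, the agreement never stops and `X` is eventually periodic.
  · refine hX i i2 hii (funext fun k => ?_)
    refine ((hagree (cut σ (shift i2 X) k + 1) fun a b hab => ?_).1 k (Nat.lt_succ_self _)).symm
    refine (hP ⟨_, i2 + a, jj i2 + b, rfl, ?_⟩).elim
    have := hcut i2
    rw [cut_add, cut_add]; omega

end Elementary

/-! ### The language of a substitution, desubstitution, and common tails. -/

section Language

variable {A C : Type*}

/-- The points of the subshift of a substitution. -/
def substSet (σ : A → List A) : Set (ℕ → A) := {x | ∀ w ∈ forbidden σ, ¬ FactorOf w x}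

theorem mem_substSet_iff {σ : A → List A} {x : ℕ → A} :
    x ∈ substSet σ ↔ ∀ i n, ∃ a m, seg x i n <:+: power σ m a := by
  constructor
  · intro hx i n
    have h1 : ¬ seg x i n ∈ forbidden σ := fun hf => hx _ hf ⟨i, by rw [length_seg]⟩
    simpa only [forbidden, Set.mem_ofPred_eq, not_forall, not_not] using h1
  · rintro hx w hw ⟨i, hi⟩
    obtain ⟨a, m, ham⟩ := hx i w.length
    rw [← hi] at ham
    exact hw a m ham

theorem shift_mem_substSet {σ : A → List A} {x : ℕ → A} (hx : x ∈ substSet σ) (n : ℕ) :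
    shift n x ∈ substSet σ := by
  rw [mem_substSet_iff] at hx ⊢
  intro i k
  rw [seg_shift]
  exact hx _ _

theorem seg_infix (x : ℕ → A) (i n : ℕ) : seg x i n <:+: seg x 0 (i + n) := by
  rw [seg_append, zero_add]; exact List.suffix_append _ _ |>.isInfix

theorem seg_prefix (x : ℕ → A) {m n : ℕ} (h : m ≤ n) : seg x 0 m <+: seg x 0 n := by
  obtain ⟨d, rfl⟩ := Nat.exists_eq_add_of_le h
  rw [seg_append]; exact List.prefix_append _ _

theorem infix_flatMap {u w : List A} (h : u <:+: w) (γ : A → List C) :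
    u.flatMap γ <:+: w.flatMap γ := by
  obtain ⟨s, t, rfl⟩ := h
  exact ⟨s.flatMap γ, t.flatMap γ, by simp only [List.flatMap_append]⟩

theorem infix_iterate_flatMap {u w : List A} (h : u <:+: w) (σ : A → List A) (n : ℕ) :
    (fun w => w.flatMap σ)^[n] u <:+: (fun w => w.flatMap σ)^[n] w := by
  induction n with
  | zero => exact h
  | succ n ih =>
    rw [Function.iterate_succ_apply', Function.iterate_succ_apply']
    exact infix_flatMap ih σ

/-- As `γ` intertwines `σ = δ ∘ γ` with `ρ = γ ∘ δ`, the image under `γ` of `σ^m(a)` is `ρ^m(γ(a))`.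
If `a` occurs in `δ c`, then `γ(a)` is a factor of `ρ(c)`, so this image is a factor of
`ρ^(m+1)(c)`. -/
theorem gact_mem_substSet {γ : A → List C} {δ : C → List A} (hγ : ∀ a, 0 < (γ a).length)
    (hδ : ∀ a, ∃ c, a ∈ δ c) {σ : A → List A} {ρ : C → List C}
    (hσ : ∀ a, (γ a).flatMap δ = σ a) (hρ : ∀ c, (δ c).flatMap γ = ρ c) {x : ℕ → A}
    (hx : x ∈ substSet σ) : gact γ hγ x ∈ substSet ρ := by
  rw [mem_substSet_iff] at hx ⊢
  intro i n
  obtain ⟨a, m, ham⟩ := hx 0 (i + n)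
  obtain ⟨c, hc⟩ := hδ a
  refine ⟨c, m + 1, (seg_infix _ _ _).trans ?_⟩
  refine ((seg_prefix _ (le_cut hγ x (i + n))).isInfix).trans ?_
  rw [seg_gact]
  refine (infix_flatMap ham γ).trans ?_
  have hsemi : Function.Semiconj (fun w : List A => w.flatMap γ) (fun w => w.flatMap σ)
      (fun w => w.flatMap ρ) := fun w => by
    simp only [List.flatMap_assoc, ← hσ, funext fun c => (hρ c).symm]
  have h1 : ((fun w => w.flatMap σ)^[m] [a]).flatMap γ = _ := (hsemi.iterate_right m) [a]
  unfold power
  rw [h1, Function.iterate_succ_apply]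
  refine infix_iterate_flatMap ?_ ρ m
  have h2 : [a] <:+: δ c := by
    obtain ⟨s, t, hst⟩ := List.append_of_mem hc
    exact ⟨s, t, by simp [hst]⟩
  simpa [hρ] using infix_flatMap h2 γ

theorem exists_suffix_of_infix_flatMap {σ : A → List A} {M : ℕ} (hM : ∀ a, (σ a).length ≤ M)
    {w : List A} (hw : w ≠ []) (u : List A) (h : w <:+: u.flatMap σ) :
    ∃ u' k, u' <:+ u ∧ k ≤ M ∧ ∃ s t, s.length = k ∧ u'.flatMap σ = s ++ (w ++ t) := by
  induction u with
  | nil => simp at h; exact (hw h).elim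
  | cons a u ih =>
    obtain ⟨s, t, hst⟩ := h
    rw [List.flatMap_cons, List.append_assoc] at hst
    rcases le_or_gt s.length (σ a).length with hl | hl
    · exact ⟨a :: u, s.length, List.suffix_rfl, hl.trans (hM a), s, t, rfl, by
        rw [List.flatMap_cons, hst]⟩
    · obtain ⟨u', k, hu', hk⟩ := ih (by
        obtain ⟨r, hr⟩ := List.prefix_of_prefix_length_le (List.prefix_append (σ a) (u.flatMap σ))
          (hst ▸ List.prefix_append s (w ++ t)) hl.le
        rw [← hr, List.append_assoc] at hst
        exact ⟨r, t, by rw [List.append_assoc]; exact List.append_cancel_left hst⟩)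
      exact ⟨u', k, hu'.trans (List.suffix_cons _ _), hk⟩

/-- Compactness: `F n` consists of the pairs `(z, k)` that are correct up to length `n`. These sets
are closed, decreasing and non-empty, and a common point solves the problem. -/
theorem exists_desubstitution [Finite A] {σ : A → List A} (h : ∀ a, 0 < (σ a).length) {M : ℕ}
    (hM : ∀ a, (σ a).length ≤ M) {x : ℕ → A} (hx : x ∈ substSet σ) :
    ∃ z ∈ substSet σ, ∃ k ≤ M, shift k (gact σ h z) = x := by
  let _ : TopologicalSpace A := ⊥
  have : DiscreteTopology A := ⟨rfl⟩
  let F : ℕ → Set ((ℕ → A) × Fin (M + 1)) := fun n =>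
    {p | (∃ a m, seg p.1 0 n <:+: power σ m a) ∧
      ∀ i, (p.2 : ℕ) + i < n → gact σ h p.1 (p.2 + i) = x i}
  have hclosed : ∀ n, IsClosed (F n) := fun n => by
    refine IsClosed.inter ?_ ?_
    · have hc : Continuous fun (p : (ℕ → A) × Fin (M + 1)) (k : Fin n) => p.1 k := by fun_prop
      have : {p : (ℕ → A) × Fin (M + 1) | ∃ a m, seg p.1 0 n <:+: power σ m a} =
          (fun (p : (ℕ → A) × Fin (M + 1)) (k : Fin n) => p.1 k) ⁻¹'
            {f | ∃ a m, List.ofFn f <:+: power σ m a} := by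
        ext p
        have : seg p.1 0 n = List.ofFn fun k : Fin n => p.1 k := by
          apply List.ext_getElem <;> simp [seg]
        simp [this]
      change IsClosed {p : (ℕ → A) × Fin (M + 1) | ∃ a m, seg p.1 0 n <:+: power σ m a}
      rw [this]
      exact (isClosed_discrete _).preimage hc
    · have : {p : (ℕ → A) × Fin (M + 1) |
            ∀ i, (p.2 : ℕ) + i < n → gact σ h p.1 (p.2 + i) = x i} =
          ⋂ k : Fin (M + 1), ⋂ i : ℕ, {p : (ℕ → A) × Fin (M + 1) |
            p.2 = k → (k : ℕ) + i < n → gact σ h p.1 (k + i) = x i} := by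
        ext p
        simp only [Set.mem_ofPred_eq, Set.mem_iInter]
        exact ⟨fun H k i hk hi => by subst hk; exact H i hi, fun H i hi => H _ i rfl hi⟩
      change IsClosed {p : (ℕ → A) × Fin (M + 1) |
            ∀ i, (p.2 : ℕ) + i < n → gact σ h p.1 (p.2 + i) = x i}
      rw [this]
      refine isClosed_iInter fun k => isClosed_iInter fun i => ?_
      have hcont : Continuous fun p : (ℕ → A) × Fin (M + 1) =>
          (p.2, gact σ h p.1 ((k : ℕ) + i)) :=
        continuous_snd.prodMk ((continuous_apply _).comp ((continuous_act h).comp continuous_fst))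
      exact (isClosed_discrete {q : Fin (M + 1) × A | q.1 = k → (k : ℕ) + i < n → q.2 = x i}).preimage
        hcont
  have hne : ∀ n, (F n).Nonempty := fun n => by
    have hMpos : 0 < M := (h (x 0)).trans_le (hM _)
    -- Length `n * M` forces at least `n` letters in the preimage; the extra `2` excludes `m = 0`,
    -- where the power is a single letter.
    set w := seg x 0 (n * M + 2) with hw
    have hwlen : w.length = n * M + 2 := length_seg _ _ _
    obtain ⟨a, m, ham⟩ := mem_substSet_iff.1 hx 0 (n * M + 2)
    cases m with
    | zero =>
      have := ham.length_le
      simp [power, length_seg] at this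
    | succ m =>
      rw [power_succ] at ham
      obtain ⟨u, k, hu, hk, s, t, hs, hut⟩ := exists_suffix_of_infix_flatMap hM
        (w := w) (List.length_pos_iff.1 (by omega)) _ ham
      have hlen : (u.flatMap σ).length ≤ u.length * M := by
        have := cut_le hM (app u x) u.length
        rwa [cut, seg_app] at this
      have hnu : n ≤ u.length := by
        have h1 := congrArg List.length hut
        rw [List.length_append, List.length_append, hwlen] at h1
        by_contra hc
        have : u.length * M ≤ n * M := Nat.mul_le_mul_right _ (by omega)
        omega
      -- What follows `u` is arbitrary padding; `x` is a convenient choice.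
      refine ⟨(app u x, ⟨k, Nat.lt_succ_of_le hk⟩), ⟨a, m, ?_⟩, fun i hi => ?_⟩
      · have h1 := seg_prefix (app u x) hnu
        rw [seg_app] at h1
        exact h1.isInfix.trans hu.isInfix
      · have h1 : shift k (gact σ h (app u x)) = app w (app t (gact σ h x)) := by
          rw [gact_app, hut, app_append, app_append, ← hs, shift_app]
        have h2 := congrFun h1 i
        rw [shift_apply] at h2
        change k + i < n at hi
        have hiw : i < w.length := by
          rw [hwlen]; nlinarith
        change gact σ h (app u x) (k + i) = x i
        rw [h2]
        simp only [app, hiw, dite_true]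
        simp [hw, seg]
  obtain ⟨⟨z, k⟩, hz⟩ := IsCompact.nonempty_iInter_of_sequence_nonempty_isCompact_isClosed F
    (fun n p hp => ⟨by
      obtain ⟨a, m, ham⟩ := hp.1
      exact ⟨a, m, (seg_prefix _ (Nat.le_succ n)).isInfix.trans ham⟩,
      fun i hi => hp.2 i (by omega)⟩) hne (hclosed 0).isCompact hclosed
  rw [Set.mem_iInter] at hz
  refine ⟨z, mem_substSet_iff.2 fun i n => ?_, k, Nat.le_of_lt_succ k.2, funext fun i => ?_⟩
  · obtain ⟨a, m, ham⟩ := (hz (i + n)).1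
    exact ⟨a, m, (seg_infix _ _ _).trans ham⟩
  · exact (hz (k + i + 1)).2 i (Nat.lt_succ_self _)

/-- `x` and `y` have a common tail, which starts at a position at most `K` in both. -/
def Near (K : ℕ) (x y : ℕ → A) : Prop := ∃ i ≤ K, ∃ j ≤ K, shift i x = shift j y

theorem Near.symm {K : ℕ} {x y : ℕ → A} (h : Near K x y) : Near K y x := by
  obtain ⟨i, hi, j, hj, hij⟩ := h
  exact ⟨j, hj, i, hi, hij.symm⟩

theorem Near.trans {K L : ℕ} {x y z : ℕ → A} (h : Near K x y) (h' : Near L y z) :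
    Near (K + L) x z := by
  obtain ⟨i, hi, j, hj, hij⟩ := h
  obtain ⟨k, hk, l, hl, hkl⟩ := h'
  refine ⟨i + k, by omega, l + j, by omega, ?_⟩
  rw [← shift_shift, hij, shift_shift, add_comm, ← shift_shift, hkl, shift_shift]

theorem near_shift (k : ℕ) (x : ℕ → A) : Near k (shift k x) x :=
  ⟨0, Nat.zero_le _, k, le_rfl, by simp⟩

theorem Near.mono {K L : ℕ} (hKL : K ≤ L) {x y : ℕ → A} (h : Near K x y) : Near L x y := by
  obtain ⟨i, hi, j, hj, hij⟩ := h
  exact ⟨i, hi.trans hKL, j, hj.trans hKL, hij⟩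

theorem Near.gact {γ : A → List C} (h : ∀ a, 0 < (γ a).length) {M : ℕ}
    (hM : ∀ a, (γ a).length ≤ M) {K : ℕ} {x y : ℕ → A} (hxy : Near K x y) :
    Near (K * M) (gact γ h x) (gact γ h y) := by
  obtain ⟨i, hi, j, hj, hij⟩ := hxy
  refine ⟨cut γ x i, (cut_le hM x i).trans (Nat.mul_le_mul_right _ hi), cut γ y j,
    (cut_le hM y j).trans (Nat.mul_le_mul_right _ hj), ?_⟩
  rw [shift_cut_gact, shift_cut_gact, hij]

theorem exists_length_bound [Finite A] (γ : A → List C) : ∃ M, ∀ a, (γ a).length ≤ M := by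
  obtain ⟨M, hM⟩ := (Set.finite_range fun a => (γ a).length).bddAbove
  exact ⟨M, fun a => hM ⟨a, rfl⟩⟩

end Language

/-! ### Uniform tail injectivity, by induction on the alphabet. -/

section TailInjectivity

/-- The subshift of `σ` has no periodic point. -/
def NoPeriodicPoint {A : Type*} (σ : A → List A) : Prop :=
  ∀ x ∈ substSet σ, ∀ p, 0 < p → shift p x ≠ x

theorem NoPeriodicPoint.shift_injective {A : Type*} {σ : A → List A} (hσ : NoPeriodicPoint σ)
    {x : ℕ → A} (hx : x ∈ substSet σ) {m n : ℕ} (h : shift m x = shift n x) : m = n := by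
  suffices H : ∀ m n, m < n → shift m x ≠ shift n x by
    rcases lt_trichotomy m n with hl | hl | hl
    · exact (H m n hl h).elim
    · exact hl
    · exact (H n m hl h.symm).elim
  intro m n hmn he
  refine hσ (shift m x) (shift_mem_substSet hx m) (n - m) (by omega) ?_
  rw [shift_shift, he]; congr 1; omega

/-- Points of the subshift whose images have a common tail have a common tail, uniformly. -/
def TailInjective {A : Type*} (σ : A → List A) (h : ∀ a, 0 < (σ a).length) : Prop :=
  ∀ K, ∃ K', ∀ x ∈ substSet σ, ∀ y ∈ substSet σ, Near K (gact σ h x) (gact σ h y) → Near K' x y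

theorem Elementary.tailInjective {A : Type*} [Fintype A] {σ : A → List A} (hE : Elementary σ)
    (h : ∀ a, 0 < (σ a).length) (hσ : NoPeriodicPoint σ) : TailInjective σ h := by
  intro K
  obtain ⟨M, hM⟩ := exists_length_bound σ
  obtain ⟨S, hS⟩ := hE.exists_coincidence h ((K + K * M) * M)
  refine ⟨K + S + (K + K * M) + S * M, fun x hx y _ hxy => ?_⟩
  obtain ⟨k, hk, l, hl, hkl⟩ := hxy
  have hp1 := le_cut h x k
  have hp2 : cut σ x k ≤ K * M := (cut_le hM x k).trans (Nat.mul_le_mul_right _ hk)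
  obtain ⟨q, hq⟩ := Nat.exists_eq_add_of_le hp1
  -- Moving to cut `k` of `σ(x)` advances by `q` to position `r` of `σ(y)`. Cut number `r` of `σ(y)`
  -- lies `d` letters further, so `d` is the overhang.
  set r := l + q with hr
  have hrK : r ≤ K + K * M := by omega
  obtain ⟨d, hd⟩ := Nat.exists_eq_add_of_le (le_cut h y r)
  have hdK : cut σ y r ≤ (K + K * M) * M := (cut_le hM y r).trans (Nat.mul_le_mul_right _ hrK)
  have hrel : gact σ h (shift k x) =
      app (seg (gact σ h (shift k x)) 0 d) (gact σ h (shift r y)) := by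
    conv_lhs => rw [← app_seg_shift (gact σ h (shift k x)) d]
    congr 1
    rw [← shift_cut_gact, ← shift_cut_gact, hq, hd, hr, shift_shift, add_assoc, add_assoc,
      ← shift_shift, hkl, shift_shift]
  obtain ⟨i, j, hi, hij, hs⟩ := hS _ _ _ (by rw [length_seg]; omega) hrel fun m n hmn he => by
    have := hσ.shift_injective (shift_mem_substSet hx k) he
    omega
  have h1 := le_cut h (shift r y) j
  have h2 : cut σ (shift k x) i ≤ S * M := (cut_le hM _ i).trans (Nat.mul_le_mul_right _ hi)
  rw [shift_shift, shift_shift] at hs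
  exact ⟨k + i, by omega, r + j, by omega, hs⟩

/-- Unused intermediate letters are discarded; otherwise `α` need not map the subshift of `β ∘ α`
into that of `σ`. -/
theorem Factors.exists_pruned {A : Type*} {B : Type*} {σ : A → List B} {n : ℕ}
    (hσ : Factors σ n) : ∃ (C : Type) (_ : Fintype C) (β : A → List C) (α : C → List B),
      Fintype.card C ≤ n ∧ (∀ c, 0 < (α c).length) ∧ (∀ a, (β a).flatMap α = σ a) ∧
      ∀ c, ∃ a, c ∈ β a := by
  classical
  obtain ⟨β, α, hα, hβ⟩ := hσ
  refine ⟨{c : Fin n // ∃ a, c ∈ β a}, inferInstance,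
    fun a => (β a).attachWith _ fun c hc => ⟨a, hc⟩, fun c => α c, ?_, fun c => hα c, fun a => ?_,
    ?_⟩
  · exact (Fintype.card_subtype_le _).trans (by simp)
  · rw [← hβ a]
    simp [List.flatMap_def]
  · rintro ⟨c, a, hc⟩
    exact ⟨a, by simpa using hc⟩

/-- Since `β σ = ρ β`, nearness of `σ(x)` and `σ(y)` gives nearness of `β(x)` and `β(y)`, but `β`
cannot be cancelled directly. Up to bounded shifts `x` and `y` are `σ(z)` and `σ(w)`, so `ρ(β(z))`
and `ρ(β(w))` are near. A second use of the property for `ρ` makes `β(z)` and `β(w)` near, and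
applying `α` returns to `σ(z)` and `σ(w)`. -/
theorem tailInjective_of_factor {A : Type*} {C : Type*} [Finite A] [Finite C]
    {σ : A → List A} {ρ : C → List C} {β : A → List C} {α : C → List A}
    (hα : ∀ c, 0 < (α c).length) (hβ : ∀ a, 0 < (β a).length)
    (hσ : ∀ a, (β a).flatMap α = σ a) (hρ : ∀ c, (α c).flatMap β = ρ c)
    (hsurj : ∀ a, ∃ c, a ∈ α c) (h : ∀ a, 0 < (σ a).length) (h' : ∀ c, 0 < (ρ c).length)
    (hTI : TailInjective ρ h') : TailInjective σ h := by
  obtain ⟨M, hM⟩ := exists_length_bound σ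
  obtain ⟨Mα, hMα⟩ := exists_length_bound α
  obtain ⟨Mβ, hMβ⟩ := exists_length_bound β
  have hβσ : ∀ x, gact β hβ (gact σ h x) = gact ρ h' (gact β hβ x) := fun x => by
    rw [← gact_gact hβ hα h hσ, gact_gact hα hβ h' hρ]
  have hmem : ∀ x ∈ substSet σ, gact β hβ x ∈ substSet ρ := fun x hx =>
    gact_mem_substSet hβ hsurj hσ hρ hx
  intro K
  obtain ⟨K₁, hK₁⟩ := hTI (K * Mβ)
  obtain ⟨K₂, hK₂⟩ := hTI (M * Mβ + K₁ + M * Mβ)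
  refine ⟨M + K₂ * Mα + M, fun x hx y hy hxy => ?_⟩
  obtain ⟨z, hz, k, hk, rfl⟩ := exists_desubstitution h hM hx
  obtain ⟨w, hw, l, hl, rfl⟩ := exists_desubstitution h hM hy
  set x := shift k (gact σ h z)
  set y := shift l (gact σ h w)
  have hxz : Near M x (gact σ h z) := (near_shift _ _).mono hk
  have hyw : Near M y (gact σ h w) := (near_shift _ _).mono hl
  have h1 := hxy.gact hβ hMβ
  rw [hβσ, hβσ] at h1
  have h2 := hK₁ _ (hmem x hx) _ (hmem y hy) h1
  have h3 := ((hxz.symm.gact hβ hMβ).trans h2).trans (hyw.gact hβ hMβ)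
  rw [hβσ, hβσ] at h3
  have h4 := (hK₂ _ (hmem z hz) _ (hmem w hw) h3).gact hα hMα
  rw [gact_gact hβ hα h hσ, gact_gact hβ hα h hσ] at h4
  exact (hxz.trans h4).trans hyw.symm

/-- Kept apart from the induction because intermediate alphabets live in `Type`, whereas `A` may lie
in any universe. -/
theorem tailInjective_step {A : Type*} [Fintype A]
    (ih : ∀ (C : Type) [Fintype C] (ρ : C → List C) (h : ∀ c, 0 < (ρ c).length),
      Fintype.card C < Fintype.card A → (∀ c, ∃ b, c ∈ ρ b) → NoPeriodicPoint ρ →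
      TailInjective ρ h)
    {σ : A → List A} (h : ∀ a, 0 < (σ a).length) (hsurj : ∀ a, ∃ b, a ∈ σ b)
    (hσ : NoPeriodicPoint σ) : TailInjective σ h := by
  by_cases hE : Elementary σ
  · exact hE.tailInjective h hσ
  unfold Elementary at hE
  push Not at hE
  obtain ⟨n, hn, hcard⟩ := hE
  obtain ⟨C, _, β, α, hC, hα, hβα, hsurjβ⟩ := hn.exists_pruned
  have hβ : ∀ a, 0 < (β a).length := fun a => by
    rw [List.length_pos_iff]
    intro h0
    have := h a
    rw [← hβα, h0] at this
    simp at this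
  have hsurjα : ∀ a, ∃ c, a ∈ α c := fun a => by
    obtain ⟨b, hb⟩ := hsurj a
    rw [← hβα, List.mem_flatMap] at hb
    obtain ⟨c, -, hc⟩ := hb
    exact ⟨c, hc⟩
  let ρ : C → List C := fun c => (α c).flatMap β
  have hρ : ∀ c, 0 < (ρ c).length := fun c => by
    obtain ⟨a, ha⟩ := List.exists_mem_of_length_pos (hα c)
    obtain ⟨c', hc'⟩ := List.exists_mem_of_length_pos (hβ a)
    exact List.length_pos_of_mem (List.mem_flatMap.2 ⟨a, ha, hc'⟩)
  refine tailInjective_of_factor hα hβ hβα (fun _ => rfl) hsurjα h hρ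
    (ih C ρ hρ (hC.trans_lt hcard) (fun c => ?_) fun x hx p hp hper => ?_)
  · obtain ⟨a, ha⟩ := hsurjβ c
    obtain ⟨c', hc'⟩ := hsurjα a
    exact ⟨c', List.mem_flatMap.2 ⟨a, hc', ha⟩⟩
  -- A periodic point for `ρ` would be mapped by `α` to a periodic point for `σ`.
  · refine hσ (gact α hα x) (gact_mem_substSet hα hsurjβ (fun _ => rfl) hβα hx) (cut α x p)
      (hp.trans_le (le_cut hα x p)) ?_
    rw [shift_cut_gact, hper]

theorem tailInjective_of_card (n : ℕ) : ∀ (C : Type) [Fintype C] (ρ : C → List C)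
    (h : ∀ c, 0 < (ρ c).length), Fintype.card C = n → (∀ c, ∃ b, c ∈ ρ b) →
    NoPeriodicPoint ρ → TailInjective ρ h := by
  induction n using Nat.strong_induction_on with
  | _ n ih =>
    intro C _ ρ h hC hs hρ
    exact tailInjective_step (fun D _ δ hδ hD => ih _ (hC ▸ hD) D δ hδ rfl) h hs hρ

theorem tailInjective {A : Type*} [Finite A] {σ : A → List A} (h : ∀ a, 0 < (σ a).length)
    (hsurj : ∀ a, ∃ b, a ∈ σ b) (hσ : NoPeriodicPoint σ) : TailInjective σ h := by
  have := Fintype.ofFinite A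
  exact tailInjective_step (fun C _ ρ hρ _ => tailInjective_of_card _ C ρ hρ rfl) h hsurj hσ

end TailInjectivity

/-! ### Indexing letters by the positions of their images. -/

section CutIndex

variable {A B : Type*} {σ : A → List B} (h : ∀ a, 0 < (σ a).length)

theorem exists_le_cut {σ : A → List B} (h : ∀ a, 0 < (σ a).length) (x : ℕ → A) (N : ℕ) :
    ∃ t, N ≤ cut σ x t := ⟨N, le_cut h x N⟩

open Classical in
/-- The index of the first cut of `σ(x)` at a position at least `N`. -/
noncomputable def idx (x : ℕ → A) (N : ℕ) : ℕ := Nat.find (exists_le_cut h x N)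

theorem le_cut_idx (x : ℕ → A) (N : ℕ) : N ≤ cut σ x (idx h x N) := by
  classical exact Nat.find_spec (exists_le_cut h x N)

theorem cut_lt_of_lt_idx {x : ℕ → A} {N s : ℕ} (hs : s < idx h x N) : cut σ x s < N := by
  classical exact not_le.1 (Nat.find_min (exists_le_cut h x N) hs)

theorem idx_eq {x : ℕ → A} {N t : ℕ} (h1 : N ≤ cut σ x t) (h2 : ∀ s < t, cut σ x s < N) :
    idx h x N = t := by
  rcases lt_trichotomy (idx h x N) t with hl | hl | hl
  · have := h2 _ hl; have := le_cut_idx h x N; omega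
  · exact hl
  · have := cut_lt_of_lt_idx h hl; omega

theorem idx_cut (x : ℕ → A) (t : ℕ) : idx h x (cut σ x t) = t :=
  idx_eq h le_rfl fun _ hs => cut_strictMono h x hs

theorem idx_congr {x y : ℕ → A} {N : ℕ} (hxy : ∀ i < idx h x N, y i = x i) :
    idx h y N = idx h x N := by
  refine idx_eq h ?_ fun s hs => ?_
  · rw [cut_congr σ hxy]; exact le_cut_idx h x N
  · rw [cut_congr σ fun i hi => hxy i (hi.trans hs)]; exact cut_lt_of_lt_idx h hs

theorem cut_idx_le {M : ℕ} (hM : ∀ a, (σ a).length ≤ M) (x : ℕ → A) (N : ℕ) :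
    cut σ x (idx h x N) ≤ N + M := by
  rcases Nat.eq_zero_or_pos (idx h x N) with h0 | h0
  · rw [h0, cut_zero]; omega
  · obtain ⟨s, hs⟩ := Nat.exists_eq_add_one.2 h0
    have h1 := cut_lt_of_lt_idx h (x := x) (N := N) (s := s) (by omega)
    have h2 := hM (x s)
    rw [hs, cut_succ]; omega

/-- The letter whose image starts at position `N` of `σ(x)`, if there is one. -/
noncomputable def letterAt (x : ℕ → A) (N : ℕ) : List A :=
  if cut σ x (idx h x N) = N then [x (idx h x N)] else []

theorem idx_succ (x : ℕ → A) (N : ℕ) :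
    idx h x (N + 1) = idx h x N + (letterAt h x N).length := by
  have h1 := le_cut_idx h x N
  have hlt : ∀ s < idx h x N, cut σ x s < N := fun s hs => cut_lt_of_lt_idx h hs
  unfold letterAt
  split_ifs with hc
  · refine idx_eq h ?_ fun s hs => ?_
    · have := cut_strictMono h x (Nat.lt_add_one (idx h x N))
      change _ ≤ cut σ x (idx h x N + 1)
      omega
    · rcases Nat.lt_succ_iff_lt_or_eq.1 hs with hs | hs
      · have := hlt s hs; omega
      · change s = idx h x N at hs
        rw [hs, hc]; exact Nat.lt_add_one N
  · rw [List.length_nil, add_zero]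
    exact idx_eq h (by omega) fun s hs => (hlt s hs).trans (Nat.lt_add_one N)

theorem letterAt_eq_seg (x : ℕ → A) (N : ℕ) :
    letterAt h x N = seg x (idx h x N) (letterAt h x N).length := by
  unfold letterAt
  split_ifs <;> simp [seg]

theorem exists_eq_cut_add {σ : A → List B} (h : ∀ a, 0 < (σ a).length) {M : ℕ}
    (hM : ∀ a, (σ a).length ≤ M) (x : ℕ → A) (k : ℕ) : ∃ t r, k = cut σ x t + r ∧ r ≤ M := by
  have h1 := le_cut_idx h x (k + 1)
  rcases Nat.eq_zero_or_pos (idx h x (k + 1)) with h0 | h0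
  · rw [h0, cut_zero] at h1; omega
  · obtain ⟨s, hs⟩ := Nat.exists_eq_add_one.2 h0
    have h2 := cut_lt_of_lt_idx h (x := x) (N := k + 1) (s := s) (by omega)
    have h3 := hM (x s)
    rw [hs, cut_succ] at h1
    exact ⟨s, k - cut σ x s, by omega, by omega⟩

end CutIndex

/-! ### Recognizability with delay, and the inverse dill map. -/

section Synchronization

/-- Once the two parsings share an aligned cut and a tail, all later cuts match, so what is read at
delay `L` is the same in both. -/
theorem idx_eq_of_synchronized {A : Type*} {τ : A → List A} (h : ∀ a, 0 < (τ a).length)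
    {x y : ℕ → A} {i j k l L : ℕ} (hij : shift i x = shift j y)
    (hcut : cut τ x i + l = cut τ y j + k)
    (hL : cut τ x i ≤ L + k) :
    shift (idx h x (L + k)) x = shift (idx h y (L + l)) y ∧
      letterAt h x (L + k) = letterAt h y (L + l) := by
  have hcuts : ∀ r, cut τ x (i + r) + l = cut τ y (j + r) + k := fun r => by
    rw [cut_add, cut_add, hij]; omega
  have hit : i ≤ idx h x (L + k) := by
    by_contra hc
    have := cut_strictMono h x (not_le.1 hc)
    have := le_cut_idx h x (L + k)
    omega
  obtain ⟨r, hr⟩ := Nat.exists_eq_add_of_le hit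
  have h1 := le_cut_idx h x (L + k)
  rw [hr] at h1
  have hu : idx h y (L + l) = j + r := by
    refine idx_eq h (by have := hcuts r; omega) fun s hs => ?_
    cases r with
    | zero =>
      have := cut_strictMono h y hs
      have := hcuts 0
      simp only [add_zero] at *
      omega
    | succ r =>
      have h2 := cut_lt_of_lt_idx h (x := x) (N := L + k) (s := i + r) (by omega)
      have h3 := (cut_strictMono h y).monotone (show s ≤ j + r by omega)
      have := hcuts r
      omega
  have hs : shift (i + r) x = shift (j + r) y := by
    rw [← shift_shift, hij, shift_shift]
  refine ⟨by rw [hr, hu, hs], ?_⟩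
  unfold letterAt
  rw [hr, hu]
  have h4 : x (i + r) = y (j + r) := by simpa [shift_apply] using congrFun hs 0
  have h5 := hcuts r
  rw [h4]
  congr 1
  exact propext ⟨fun _ => by omega, fun _ => by omega⟩

variable {A : Type*} [TopologicalSpace A] [DiscreteTopology A] {τ : A → List A}

theorem exists_synchronization [Finite A] (h : ∀ a, 0 < (τ a).length)
    (hτ : NoPeriodicPoint τ) (hTI : TailInjective τ h) :
    ∃ L, ∀ x ∈ substSet τ, ∀ y ∈ substSet τ, ∀ k l,
      shift k (gact τ h x) = shift l (gact τ h y) →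
        ∃ i j, shift i x = shift j y ∧ cut τ x i + l = cut τ y j + k ∧ cut τ x i ≤ L + k := by
  obtain ⟨M, hM⟩ := exists_length_bound τ
  obtain ⟨K, hK⟩ := hTI M
  refine ⟨K * M, fun x hx y hy k l hkl => ?_⟩
  obtain ⟨t, r, hk, hr⟩ := exists_eq_cut_add h hM x k
  obtain ⟨u, s, hl, hs⟩ := exists_eq_cut_add h hM y l
  obtain ⟨i, hi, j, hj, hij⟩ := hK _ (shift_mem_substSet hx t) _ (shift_mem_substSet hy u)
    ⟨r, hr, s, hs, by rw [← shift_cut_add_gact, ← shift_cut_add_gact, ← hk, ← hl, hkl]⟩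
  rw [shift_shift, shift_shift] at hij
  refine ⟨t + i, u + j, hij, ?_, ?_⟩
  -- Shifting the common point by `cut τ x (t + i) + l` or by `cut τ y (u + j) + k` yields the same
  -- tail, so aperiodicity makes these numbers equal.
  · have hmem : shift k (gact τ h x) ∈ substSet τ :=
      shift_mem_substSet (act_mem (τ := τ) h hx) k
    refine hτ.shift_injective hmem ?_
    conv_rhs => rw [hkl]
    rw [shift_shift, shift_shift,
      show k + (cut τ x (t + i) + l) = cut τ x (t + i) + (k + l) by ring,
      show l + (cut τ y (u + j) + k) = cut τ y (u + j) + (k + l) by ring,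
      shift_cut_add_gact, shift_cut_add_gact, hij]
  · rw [cut_add]
    have := (cut_le hM (shift t x) i).trans (Nat.mul_le_mul_right _ hi)
    omega

theorem eventually_agree (M n : ℕ) (p : (substShift τ).carrier × Fin M) :
    ∀ᶠ q in 𝓝 p, q.2 = p.2 ∧ ∀ i < n, q.1.1 i = p.1.1 i := by
  refine Eventually.and ?_ ?_
  · exact (continuous_snd.tendsto p).eventually ((isOpen_discrete {p.2}).mem_nhds rfl)
  · have : ∀ i ∈ Finset.range n, ∀ᶠ q in 𝓝 p, q.1.1 i = p.1.1 i := fun i _ =>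
      (((continuous_apply i).comp (continuous_subtype_val.comp continuous_fst)).tendsto
        p).eventually ((isOpen_discrete {p.1.1 i}).mem_nhds rfl)
    simpa using (Filter.eventually_all_finset _).2 this

theorem exists_inverse_implementation [Finite A] (h : ∀ a, 0 < (τ a).length) 
    (hτ : NoPeriodicPoint τ) (hTI : TailInjective τ h) :
    ∃ (Ψ : DillMap (substShift τ) (substShift τ)) (ψ : (substShift τ).carrier → List A) (L : ℕ),
      IsImplementation Ψ ψ ∧
      (∀ y : (substShift τ).carrier, ∃ (x : (substShift τ).carrier) (k : ℕ),
        sh _ k ((substMap τ h).toFun x) = y) ∧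
      ∀ (x : (substShift τ).carrier) (k : ℕ),
        Ψ.toFun (sh _ k ((substMap τ h).toFun x)) = sh _ (idx h x.1 (L + k)) x ∧
        ∀ n, idx h x.1 (L + k) + (iter ψ n (sh _ k ((substMap τ h).toFun x))).length =
          idx h x.1 (L + k + n) := by
  classical
  obtain ⟨M, hM⟩ := exists_length_bound τ
  obtain ⟨L, hL⟩ := exists_synchronization h hτ hTI
  set X := substShift τ with hX
  have hrep : ∀ y : X.carrier, ∃ (x : X.carrier) (k : Fin (M + 1)),
      sh X k ((substMap τ h).toFun x) = y := fun y => by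
    obtain ⟨z, hz, k, hk, hzk⟩ := exists_desubstitution h hM (x := y.1) y.2
    exact ⟨⟨z, hz⟩, ⟨k, Nat.lt_succ_of_le hk⟩, Subtype.ext hzk⟩
  choose P Q hPQ using hrep
  let Ψ : X.carrier → X.carrier := fun y => sh X (idx h (P y).1 (L + Q y)) (P y)
  let ψ : X.carrier → List A := fun y => letterAt h (P y).1 (L + Q y)
  -- Independence of the chosen representation `(P y, Q y)`: any other one yields the same values.
  have key : ∀ (x : X.carrier) (k : ℕ),
      Ψ (sh X k ((substMap τ h).toFun x)) = sh X (idx h x.1 (L + k)) x ∧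
      ψ (sh X k ((substMap τ h).toFun x)) = letterAt h x.1 (L + k) := fun x k => by
    set y := sh X k ((substMap τ h).toFun x)
    have he : shift (Q y : ℕ) (gact τ h (P y).1) = shift k (gact τ h x.1) :=
      congrArg Subtype.val (hPQ y)
    obtain ⟨i, j, h1, h2, h3⟩ := hL _ (P y).2 _ x.2 _ _ he
    obtain ⟨h4, h5⟩ := idx_eq_of_synchronized h h1 h2 h3
    exact ⟨Subtype.ext h4, h5⟩
  have hsh : ∀ (x : X.carrier) (k n : ℕ), sh X n (sh X k x) = sh X (k + n) x :=
    fun x k n => Subtype.ext (shift_shift _ _ _)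
  have : CompactSpace X.carrier := isCompact_iff_compactSpace.1 X.isClosed.isCompact
  let q : X.carrier × Fin (M + 1) → X.carrier := fun p => sh X p.2 ((substMap τ h).toFun p.1)
  have hsurj : Function.Surjective q := fun y => ⟨(P y, Q y), hPQ y⟩
  have hlocal : ∀ {β : Type _} (f : X.carrier × Fin (M + 1) → β),
      (∀ p, ∃ n, ∀ r, r.2 = p.2 → (∀ i < n, r.1.1 i = p.1.1 i) → f r = f p) →
        IsLocallyConstant f := fun f hf => by
    rw [IsLocallyConstant.iff_eventually_eq]
    intro p
    obtain ⟨n, hn⟩ := hf p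
    filter_upwards [eventually_agree (M + 1) n p] with r hr using hn r hr.1 hr.2
  have hqc : Continuous q := by
    refine Continuous.subtype_mk (continuous_pi fun i => ?_) _
    refine (IsLocallyConstant.continuous (hlocal _ fun p => ⟨p.2 + i + 1, fun r hr hri => ?_⟩))
    change gact τ h r.1.1 (r.2 + i) = gact τ h p.1.1 (p.2 + i)
    have hs : seg r.1.1 0 (p.2 + i + 1) = seg p.1.1 0 (p.2 + i + 1) := by
      simp only [seg, zero_add, List.map_inj_left, List.mem_range]
      exact hri
    unfold gact
    simp only [hr, hs]
  -- The choice functions `P` and `Q` need not be continuous. As `q` is a continuous surjection from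
  -- a compact space to a Hausdorff one, continuity of `Ψ` and `ψ` can be tested after composing
  -- with `q`.
  have hq : IsQuotientMap q := IsQuotientMap.of_surjective_continuous hsurj hqc
  have hidx : ∀ (p r : X.carrier × Fin (M + 1)), r.2 = p.2 →
      (∀ i < idx h p.1.1 (L + p.2) + 1, r.1.1 i = p.1.1 i) →
      idx h r.1.1 (L + r.2) = idx h p.1.1 (L + p.2) := fun p r hr hri => by
    rw [hr]
    exact idx_congr h fun i hi => hri i (by omega)
  have hψ : IsLocallyConstant ψ := by
    have : IsLocallyConstant (ψ ∘ q) := hlocal _ fun p =>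
      ⟨idx h p.1.1 (L + p.2) + 1, fun r hr hri => by
        have h1 := hidx p r hr hri
        change ψ (sh X r.2 ((substMap τ h).toFun r.1)) = ψ (sh X p.2 ((substMap τ h).toFun p.1))
        rw [(key _ _).2, (key _ _).2]
        unfold letterAt
        rw [h1, hr, hri _ (Nat.lt_add_one _), cut_congr τ fun i hi => hri i (by omega)]⟩
    exact fun s => hq.isOpen_preimage.1 (this s)
  have hΨ : Continuous Ψ := by
    rw [hq.continuous_iff]
    refine continuous_induced_rng.2 (continuous_pi fun i => IsLocallyConstant.continuous ?_)
    refine hlocal _ fun p => ⟨idx h p.1.1 (L + p.2) + 1 + i, fun r hr hri => ?_⟩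
    have h1 := hidx p r hr fun i hi => hri i (by omega)
    change (Ψ (sh X r.2 ((substMap τ h).toFun r.1))).1 i =
      (Ψ (sh X p.2 ((substMap τ h).toFun p.1))).1 i
    rw [(key _ _).1, (key _ _).1, h1]
    exact hri _ (by omega)
  have hsucc : ∀ y, Ψ (sh X 1 y) = sh X (ψ y).length (Ψ y) := fun y => by
    obtain ⟨⟨x, k⟩, rfl⟩ := hsurj y
    change Ψ (sh X 1 (sh X k ((substMap τ h).toFun x))) = _
    rw [hsh, (key _ _).1]
    change _ = sh X (ψ (sh X k ((substMap τ h).toFun x))).length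
      (Ψ (sh X k ((substMap τ h).toFun x)))
    rw [(key _ _).1, (key _ _).2, hsh, ← idx_succ, add_assoc]
  have hpos : ∀ y, ∃ n, 0 < (ψ (sh X n y)).length := fun y => by
    obtain ⟨⟨x, k⟩, rfl⟩ := hsurj y
    have h1 := le_cut h x.1 (L + k)
    -- This waiting time brings the reading position exactly onto a cut.
    refine ⟨cut τ x.1 (L + k) - (L + k), ?_⟩
    change 0 < (ψ (sh X _ (sh X k ((substMap τ h).toFun x)))).length
    rw [hsh, (key _ _).2, ← add_assoc, Nat.add_sub_cancel' h1]
    simp [letterAt, idx_cut]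
  have hiter : ∀ (x : X.carrier) (k n : ℕ),
      idx h x.1 (L + k) + (iter ψ n (sh X k ((substMap τ h).toFun x))).length =
        idx h x.1 (L + k + n) ∧
      iter ψ n (sh X k ((substMap τ h).toFun x)) =
        seg x.1 (idx h x.1 (L + k)) (iter ψ n (sh X k ((substMap τ h).toFun x))).length := by
    intro x k n
    induction n with
    | zero => simp [iter, seg]
    | succ n ih =>
      set y := sh X k ((substMap τ h).toFun x)
      have h1 : iter ψ (n + 1) y = iter ψ n y ++ letterAt h x.1 (L + k + n) := by
        have : iter ψ (n + 1) y = iter ψ n y ++ ψ (sh X n y) := by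
          simp [iter, List.range_succ]
        rw [this, hsh, (key _ _).2, add_assoc]
      rw [h1, List.length_append, ← add_assoc, ih.1, ← idx_succ]
      refine ⟨rfl, ?_⟩
      rw [seg_append, ih.1, ← ih.2, ← letterAt_eq_seg]
  refine ⟨⟨Ψ, hΨ, fun y => (ψ y).length, (hψ.comp List.length).continuous, hsucc, hpos⟩, ψ, L,
    ⟨hψ, fun y i => ?_⟩, fun y => ⟨P y, Q y, hPQ y⟩, fun x k => ⟨(key x k).1, fun n =>
      (hiter x k n).1⟩⟩
  obtain ⟨⟨x, k⟩, rfl⟩ := hsurj y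
  change ∃ n, (iter ψ n (sh X k ((substMap τ h).toFun x)))[i]? =
    some ((Ψ (sh X k ((substMap τ h).toFun x))).1 i)
  set t := idx h x.1 (L + k) with ht
  have h1 : L + k ≤ cut τ x.1 (t + i + 1) :=
    (le_cut_idx h x.1 (L + k)).trans ((cut_strictMono h x.1).monotone (by omega))
  obtain ⟨h2, h3⟩ := hiter x k (cut τ x.1 (t + i + 1) - (L + k))
  rw [Nat.add_sub_cancel' h1, idx_cut, ← ht] at h2
  -- Reading up to cut `t + i + 1` emits exactly `i + 1` letters.
  refine ⟨cut τ x.1 (t + i + 1) - (L + k), ?_⟩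
  have h4 : (iter ψ (cut τ x.1 (t + i + 1) - (L + k))
    (sh X k ((substMap τ h).toFun x))).length = i + 1 := by omega
  rw [h3, h4, (key _ _).1]
  simp [seg, sh, shift_apply]

end Synchronization

/-! ### Growth of implementations. -/

section Growth

variable {A : Type*} [TopologicalSpace A]

theorem iter_add {X : Subshift A ℕ} {B : Type*} (φ : X.carrier → List B) (m n : ℕ)
    (x : X.carrier) : iter φ (m + n) x = iter φ m x ++ iter φ n (sh X m x) := by
  have hsh : ∀ k, sh X k (sh X m x) = sh X (m + k) x :=
    fun k => Subtype.ext (shift_shift _ _ _)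
  simp only [iter, List.range_add, List.flatMap_append, List.flatMap_map, hsh]

theorem IsImplementation.shift_eq {X Y : Subshift A ℕ} {Φ : DillMap X Y}
    {φ : X.carrier → List A} (hφ : IsImplementation Φ φ) (n : ℕ) (x : X.carrier) :
    shift (iter φ n x).length (Φ.toFun x).1 = (Φ.toFun (sh X n x)).1 := by
  funext i
  obtain ⟨m, hm⟩ := hφ.2 (sh X n x) i
  obtain ⟨m', hm'⟩ := hφ.2 x ((iter φ n x).length + i)
  have h1 : (iter φ (n + m) x)[(iter φ n x).length + i]? = some ((Φ.toFun (sh X n x)).1 i) := by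
    rw [iter_add, List.getElem?_append_right (Nat.le_add_right _ _), Nat.add_sub_cancel_left, hm]
  have h2 : ∀ {a b j : ℕ} {u : A}, (iter φ a x)[j]? = some u →
      (iter φ (a + b) x)[j]? = some u := fun {a b j u} hu => by
    obtain ⟨hj, -⟩ := List.getElem?_eq_some_iff.1 hu
    rw [iter_add, List.getElem?_append_left hj, hu]
  have h3 := h2 (b := m') h1
  have h4 := h2 (b := n + m) hm'
  rw [add_comm m', h3] at h4
  exact (Option.some.inj h4).symm

/-- Shifting `τ(x)` by either length gives `τ(σ^n(x))`, so aperiodicity makes them equal. Thus any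
implementation witnessing balanced growth bounds the cuts. -/
theorem IsImplementation.length_iter [DiscreteTopology A] {τ : A → List A} (h : NonErasing τ)
    (hτ : NoPeriodicPoint τ) {φ : (substShift τ).carrier → List A}
    (hφ : IsImplementation (substMap τ h) φ) (n : ℕ) (x : (substShift τ).carrier) :
    (iter φ n x).length = cut τ x.1 n := by
  refine hτ.shift_injective (act_mem h x.2) ?_
  refine (hφ.shift_eq n x).trans ?_
  exact (shift_cut_gact h x.1 n).symm

theorem hasZ_hasD_of_bounded {X : Subshift A ℕ} {B : Type*} {φ : X.carrier → List B} {lam : ℝ}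
    {C : ℝ} (hC : ∀ x n, |((iter φ n x).length : ℝ) - lam * n| ≤ C) :
    HasZ φ lam ∧ ∃ D, HasD φ lam D := by
  classical
  constructor
  · intro x
    rw [tendsto_iff_norm_sub_tendsto_zero]
    refine squeeze_zero' (Eventually.of_forall fun _ => norm_nonneg _) ?_
      (tendsto_const_div_atTop_nhds_zero_nat C)
    filter_upwards [eventually_gt_atTop 0] with n hn
    have hn' : (0 : ℝ) < n := Nat.cast_pos.2 hn
    rw [Real.norm_eq_abs, le_div_iff₀ hn', ← abs_of_pos hn', ← abs_mul, abs_of_pos hn', sub_mul,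
      div_mul_cancel₀ _ hn'.ne']
    exact hC x n
  · have hex : ∃ D : ℕ, ∀ (x : X.carrier) (n : ℕ),
        ((iter φ n x).length : ℝ) ∈ Set.Icc (lam * n - D) (lam * n + D) := by
      obtain ⟨D, hD⟩ := exists_nat_ge C
      refine ⟨D, fun x n => ?_⟩
      have := abs_le.1 ((hC x n).trans hD)
      constructor <;> linarith
    exact ⟨Nat.find hex, Nat.find_spec hex, fun D hD => Nat.find_min' hex hD⟩

theorem one_le_of_hasZ {τ : A → List A} [DiscreteTopology A] (h : NonErasing τ)
    {φ : (substShift τ).carrier → List A} {lam : ℝ}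
    (hφ : ∀ n x, (iter φ n x).length = cut τ x.1 n) (hZ : HasZ φ lam)
    (x : (substShift τ).carrier) : 1 ≤ lam := by
  refine ge_of_tendsto (hZ x) ?_
  filter_upwards [eventually_gt_atTop 0] with n hn
  rw [le_div_iff₀ (Nat.cast_pos.2 hn), one_mul, hφ]
  exact_mod_cast le_cut h x.1 n

end Growth

end Dill

/-! ### The almost inverse and its growth. -/

theorem mainTheorem5 {A : Type*} [Finite A] [TopologicalSpace A] [DiscreteTopology A]
    (τ : A → List A) (hprim : Dill.Primitive τ) (haper : Dill.Aperiodic τ) :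
    Dill.AlmostInvertible (Dill.substMap τ hprim.nonErasing) ∧
      (Dill.BalancedGrowth (Dill.substMap τ hprim.nonErasing) →
        ∃ Ψ : Dill.DillMap (Dill.substShift τ) (Dill.substShift τ),
          Dill.IsAlmostInverse Ψ (Dill.substMap τ hprim.nonErasing) ∧
            Dill.BalancedGrowth Ψ) := by
  have h : ∀ a, 0 < (τ a).length := hprim.nonErasing
  have hsurj : ∀ a, ∃ b, a ∈ τ b := fun a => by
    obtain ⟨N, hN⟩ := hprim
    have h1 := hN (N + 1) (Nat.le_succ N) a a
    rw [Dill.power_succ, List.mem_flatMap] at h1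
    obtain ⟨b, -, hb⟩ := h1
    exact ⟨b, hb⟩
  have hper : Dill.NoPeriodicPoint τ := haper
  obtain ⟨Ψ, ψ, L, hψ, hrep, hΨ⟩ := Dill.exists_inverse_implementation h hper
    (Dill.tailInjective h hsurj hper)
  have hinv : Dill.IsAlmostInverse Ψ (Dill.substMap τ h) := by
    refine ⟨fun x => ⟨0, Dill.idx h x.1 (L + 0), ?_⟩, fun y => ?_⟩
    · have h0 : ∀ y : (Dill.substShift τ).carrier, Dill.sh _ 0 y = y :=
        fun y => Subtype.ext (Dill.shift_zero' _)
      rw [h0]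
      have := (hΨ x 0).1
      rwa [h0] at this
    · obtain ⟨x, k, rfl⟩ := hrep y
      have h1 := Dill.le_cut_idx h x.1 (L + k)
      refine ⟨0, Dill.cut τ x.1 (Dill.idx h x.1 (L + k)) - k, Subtype.ext ?_⟩
      simp only [Function.comp_apply, (hΨ x k).1, id]
      change SymbolicDynamics.FullShift.shift 0 (Dill.gact τ h
        (SymbolicDynamics.FullShift.shift _ x.1)) = SymbolicDynamics.FullShift.shift _
          (SymbolicDynamics.FullShift.shift k (Dill.gact τ h x.1))
      rw [Dill.shift_shift, Dill.shift_zero', ← Dill.shift_cut_gact]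
      congr 1; omega
  refine ⟨⟨Ψ, hinv⟩, fun hbal => ⟨Ψ, hinv, ψ, hψ, ?_⟩⟩
  obtain ⟨φ, hφ, lam, D, hZ, hD⟩ := hbal
  have hlen := hφ.length_iter h hper
  obtain ⟨M, hM⟩ := Dill.exists_length_bound τ
  -- The `r` letters emitted in `n` steps have images of total length within `M` of `n`, as each end
  -- is rounded up to a cut, and within `D` of `lam * r`. Dividing by `lam ≥ 1` does not enlarge the
  -- error.
  suffices H : ∀ y n, |((Dill.iter ψ n y).length : ℝ) - lam⁻¹ * n| ≤ D + M by
    obtain ⟨h1, D', h2⟩ := Dill.hasZ_hasD_of_bounded H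
    exact ⟨lam⁻¹, D', h1, h2⟩
  intro y n
  obtain ⟨x, k, rfl⟩ := hrep y
  have hlam : 1 ≤ lam := Dill.one_le_of_hasZ h hlen hZ x
  have h1 := (hΨ x k).2 n
  set r := (Dill.iter ψ n (Dill.sh _ k ((Dill.substMap τ h).toFun x))).length
  have h2 := Dill.cut_add τ x.1 (Dill.idx h x.1 (L + k)) r
  rw [h1] at h2
  have h3 := Dill.le_cut_idx h x.1 (L + k)
  have h4 := Dill.le_cut_idx h x.1 (L + k + n)
  have h5 := Dill.cut_idx_le h hM x.1 (L + k)
  have h6 := Dill.cut_idx_le h hM x.1 (L + k + n)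
  obtain ⟨h7, h8⟩ := hD.1 (Dill.sh _ (Dill.idx h x.1 (L + k)) x) r
  rw [hlen] at h7 h8
  change lam * r - D ≤ (Dill.cut τ (SymbolicDynamics.FullShift.shift _ x.1) r : ℝ) at h7
  change (Dill.cut τ (SymbolicDynamics.FullShift.shift _ x.1) r : ℝ) ≤ lam * r + D at h8
  set c := Dill.cut τ (SymbolicDynamics.FullShift.shift (Dill.idx h x.1 (L + k)) x.1) r
  have h9 : (n : ℝ) ≤ c + M := by exact_mod_cast (by omega : n ≤ c + M)
  have h10 : (c : ℝ) ≤ n + M := by exact_mod_cast (by omega : c ≤ n + M)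
  have hlam0 : 0 < lam := by linarith
  have h11 : |lam * r - n| ≤ D + M := by rw [abs_le]; constructor <;> linarith
  have h12 : (r : ℝ) - lam⁻¹ * n = lam⁻¹ * (lam * r - n) := by field_simp
  rw [h12, abs_mul, abs_of_pos (inv_pos.2 hlam0)]
  calc lam⁻¹ * |lam * r - n| ≤ 1 * |lam * r - n| :=
        mul_le_mul_of_nonneg_right (inv_le_one_of_one_le₀ hlam) (abs_nonneg _)
    _ ≤ D + M := by rw [one_mul]; exact h11
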